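/- Consider the isosceles Schwarzschild three-body problem: two equal masses $M>0$ lie symmetrically about their midpoint $O$ in a horizontal plane, at mutual distance $R>0$, and a third mass $m>0$ moves on the vertical axis through $O$, at height $z$. With parameters $A,B,A_1,B_1>0$ and total angular momentum $C\in\mathbb R$, the reduced motion is the Hamiltonian system in $(R,z,P_R,P_z)\in(0,\infty)\times\mathbb R^3$ with $$H=\frac1M\Big(P_R^2+\frac{C^2}{R^2}\Big)+\frac{2M+m}{4Mm}P_z^2-\frac AR-\frac B{R^3}-\frac{4A_1}{(R^2+4z^2)^{1/2}}-\frac{16B_1}{(R^2+4z^2)^{3/2}} .$$ Put $\mu=\frac{2M+m}{m}$ and assume that $M$ is large with respect to $m$ in the sense that $$\mu>1+\frac{A}{4A_1},\qquad \mu>1+\frac{B}{16B_1},$$ together with the genericity condition $(\mu-1)^{4/15}\big(\tfrac{4A_1}{A}\big)^{2/3}\ne\big(\tfrac{16B_1}{B}\big)^{2/5}$. An initial condition leads to triple collision if its solution exists with $R>0$ on some interval $[0,T)$, $0<T<\infty$, and $R(t)\to0$, $z(t)\to0$ as $t\to T^-$. Then for every $C\in\mathbb R$ and every $h\in\mathbb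 R$, the set of initial conditions on the energy level $\{H=h\}\subset(0,\infty)\times\mathbb R^3$ that lead to triple collision has positive three-dimensional Lebesgue (surface) measure; more precisely, it contains a Borel set of positive three-dimensional surface measure. Moreover, introduce McGehee coordinates $(r,v,\theta,u)$, $-\frac\pi2<\theta<\frac\pi2$, by $$R=\sqrt{\tfrac2M}\,r\cos\theta,\quad z=\sqrt{\tfrac{2M+m}{2Mm}}\,r\sin\theta,\quad P_R=\sqrt{\tfrac M2}\,\frac{v\cos\theta-u\sin\theta}{r^{3/2}},\quad P_z=\sqrt{\tfrac{2Mm}{2M+m}}\,\frac{v\sin\theta+u\cos\theta}{r^{3/2}}$$ and the time $\tau$ with $dt=r^{5/2}d\tau$. With $$V(\theta)=\big(\tfrac M2\big)^{1/2}\Big(\tfrac{A}{\cos\theta}+\tfrac{4A_1}{(\cos^2\theta+\mu\sin^2\theta)^{1/2}}\Big),\qquad W(\theta)=\big(\tfrac M2\big)^{3/2}\Big(\tfrac{B}{\cos^3\theta}+\tfrac{16B_1}{(\cos^2\theta+\mu\sin^2\theta)^{3/2}}\Big)$$ the equations of motion become $$r'=rv,\quad v'=\tfrac32v^2+u^2+\tfrac{C^2}{\cos^2\theta}r-r^2V(\theta)-3W(\theta),\quad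 \theta'=u,\quad u'=\tfrac12uv-C^2\tfrac{\sin\theta}{\cos^3\theta}r+r^2V'(\theta)+W'(\theta),$$ which are regular at $r=0$, and the energy level becomes $$\Sigma_{h}=\Big\{r\ge0,\ |\theta|<\tfrac\pi2,\ \tfrac12(u^2+v^2)+\tfrac{C^2}{2\cos^2\theta}r-r^2V(\theta)-W(\theta)-hr^3=0\Big\}.$$ The point $Q^*=(0,-\sqrt{2W(0)},0,0)$ lies on the collision manifold $\{r=0,\ u^2+v^2=2W(\theta)\}$. It is a hyperbolic sink on the energy level: it is an equilibrium, the tangent space of the energy hypersurface at $Q^*$ has dimension $3$ and is invariant under the linearization, and all eigenvalues of the linearization on it have negative real part. Its stable manifold in $\Sigma_h$ (the points of $\Sigma_h$ whose forward orbit exists for all $\tau\ge0$, stays in $\Sigma_h$ and converges to $Q^*$) has full dimension $3$: it contains a neighbourhood of $Q^*$ in $\Sigma_h$. Every point of it with $r>0$ corresponds to an initial condition on $\{H=h\}$ that leads to triple collision. -/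

import Mathlib

open Set Filter Topology MeasureTheory

noncomputable section

/-- The parameters of the isosceles Schwarzschild problem: the two equal masses `M`, the third
mass `m`, the coefficients `A`, `B` of the interaction between the equal masses and the
coefficients `A₁`, `B₁` of the interaction between `m` and each mass `M`. -/
structure IsoscelesParams where
  M : ℝ
  m : ℝ
  A : ℝ
  B : ℝ
  A₁ : ℝ
  B₁ : ℝ

namespace IsoscelesParams

variable (P : IsoscelesParams)

/-- The mass ratio `μ = (2M + m) / m = 1 + 2M / m`. -/
def mu : ℝ := (2 * P.M + P.m) / P.m

/-! ### The reduced Hamiltonian system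

A point of `EuclideanSpace ℝ (Fin 4)` is read as `(R, z, P_R, P_z)`: `R` is the distance between
the two equal masses, `z` the height of `m` over their midpoint. The phase space is `{R > 0}`, and
the total angular momentum `C` is a parameter. -/

/-- The reduced Hamiltonian `H_red(R, z, P_R, P_z; C)`. -/
def hamiltonian (C : ℝ) (x : EuclideanSpace ℝ (Fin 4)) : ℝ :=
  (1 / P.M) * ((x 2) ^ 2 + C ^ 2 / (x 0) ^ 2)
    + (2 * P.M + P.m) / (4 * P.M * P.m) * (x 3) ^ 2
    - P.A / x 0 - P.B / (x 0) ^ 3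
    - 4 * P.A₁ / √((x 0) ^ 2 + 4 * (x 1) ^ 2)
    - 16 * P.B₁ / √((x 0) ^ 2 + 4 * (x 1) ^ 2) ^ 3

/-- The energy level `{H_red = h}` in the phase space `{R > 0}`. -/
def energyLevel (C h : ℝ) : Set (EuclideanSpace ℝ (Fin 4)) :=
  {x | 0 < x 0 ∧ P.hamiltonian C x = h}

/-- The Hamiltonian vector field
`(∂H/∂P_R, ∂H/∂P_z, -∂H/∂R, -∂H/∂z)` of the reduced Hamiltonian. -/
def hamiltonianField (C : ℝ) (x : EuclideanSpace ℝ (Fin 4)) : EuclideanSpace ℝ (Fin 4) :=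
  !₂[2 / P.M * x 2,
     (2 * P.M + P.m) / (2 * P.M * P.m) * x 3,
     -(-(2 * C ^ 2 / (P.M * (x 0) ^ 3)) + P.A / (x 0) ^ 2 + 3 * P.B / (x 0) ^ 4
        + 4 * P.A₁ * x 0 / √((x 0) ^ 2 + 4 * (x 1) ^ 2) ^ 3
        + 3 * 16 * P.B₁ * x 0 / √((x 0) ^ 2 + 4 * (x 1) ^ 2) ^ 5),
     -((4 * P.A₁ / √((x 0) ^ 2 + 4 * (x 1) ^ 2) ^ 3
        + 3 * 16 * P.B₁ / √((x 0) ^ 2 + 4 * (x 1) ^ 2) ^ 5) * (4 * x 1))]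

/-- The initial condition `x₀` leads to triple collision: the solution of the equations of motion
that starts at `x₀` exists (without double collision, `R > 0`) on some interval `[0, T)` with
`T < ∞`, and `R → 0` and `z → 0` as `t → T⁻`. -/
def LeadsToTripleCollision (C : ℝ) (x₀ : EuclideanSpace ℝ (Fin 4)) : Prop :=
  ∃ (T : ℝ) (γ : ℝ → EuclideanSpace ℝ (Fin 4)),
    0 < T ∧ γ 0 = x₀ ∧
    (∀ t ∈ Ico 0 T, 0 < γ t 0 ∧
      HasDerivWithinAt γ (P.hamiltonianField C (γ t)) (Ico 0 T) t) ∧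
    Tendsto (fun t => γ t 0) (𝓝[<] T) (𝓝 0) ∧
    Tendsto (fun t => γ t 1) (𝓝[<] T) (𝓝 0)

/-- The set of initial conditions on the energy level `h` that lead to triple collision. -/
def tripleCollisionSet (C h : ℝ) : Set (EuclideanSpace ℝ (Fin 4)) :=
  {x | x ∈ P.energyLevel C h ∧ P.LeadsToTripleCollision C x}

/-! ### McGehee coordinates

Here a point of `EuclideanSpace ℝ (Fin 4)` is read as `(r, v, θ, u)` with `r ≥ 0` and
`-π/2 < θ < π/2`; the triple collision corresponds to `r = 0`. With the diagonal mass matrix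
`T = diag (M/2, 2Mm/(2M+m))`, configuration `x = (R, z)` and momentum `p = (P_R, P_z)`, they are
given by `r² = xᵀ T x`, `s = x / r = T^{-1/2} (cos θ, sin θ)`, `v = r^{3/2} (s · p)` and
`r^{3/2} (T⁻¹ p - (s · p) s) = u T^{-1/2} (-sin θ, cos θ)`; the new time is `τ` with
`dt = r^{5/2} dτ`. -/

/-- The Newtonian part `V(θ)` of the potential. -/
def potV (θ : ℝ) : ℝ :=
  √(P.M / 2) * (P.A / Real.cos θ
    + 4 * P.A₁ / √(Real.cos θ ^ 2 + P.mu * Real.sin θ ^ 2))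

/-- The part `W(θ)` of the potential that comes from the inverse cubic terms. -/
def potW (θ : ℝ) : ℝ :=
  √(P.M / 2) ^ 3 * (P.B / Real.cos θ ^ 3
    + 16 * P.B₁ / √(Real.cos θ ^ 2 + P.mu * Real.sin θ ^ 2) ^ 3)

/-- The original variables `(R, z, P_R, P_z)` in terms of `(r, v, θ, u)`, for `r > 0`. -/
def fromMcGehee (y : EuclideanSpace ℝ (Fin 4)) : EuclideanSpace ℝ (Fin 4) :=
  !₂[√(2 / P.M) * (y 0 * Real.cos (y 2)),
     √((2 * P.M + P.m) / (2 * P.M * P.m)) * (y 0 * Real.sin (y 2)),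
     √(P.M / 2) * ((y 1 * Real.cos (y 2) - y 3 * Real.sin (y 2)) / √(y 0) ^ 3),
     √(2 * P.M * P.m / (2 * P.M + P.m)) *
        ((y 1 * Real.sin (y 2) + y 3 * Real.cos (y 2)) / √(y 0) ^ 3)]

/-- The vector field of the equations of motion in McGehee coordinates, with respect to `τ`. -/
def mcGeheeField (C : ℝ) (y : EuclideanSpace ℝ (Fin 4)) : EuclideanSpace ℝ (Fin 4) :=
  !₂[y 0 * y 1,
     3 / 2 * (y 1) ^ 2 + (y 3) ^ 2 + C ^ 2 / Real.cos (y 2) ^ 2 * y 0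
        - (y 0) ^ 2 * P.potV (y 2) - 3 * P.potW (y 2),
     y 3,
     1 / 2 * (y 3 * y 1) - C ^ 2 * (Real.sin (y 2) / Real.cos (y 2) ^ 3) * y 0
        + (y 0) ^ 2 * deriv P.potV (y 2) + deriv P.potW (y 2)]

/-- The energy relation of level `h` in McGehee coordinates is `energyRelation C h y = 0`. -/
def energyRelation (C h : ℝ) (y : EuclideanSpace ℝ (Fin 4)) : ℝ :=
  1 / 2 * ((y 3) ^ 2 + (y 1) ^ 2) + C ^ 2 / (2 * Real.cos (y 2) ^ 2) * y 0
    - (y 0) ^ 2 * P.potV (y 2) - P.potW (y 2) - h * (y 0) ^ 3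

/-- The energy level `h` in McGehee coordinates, with its boundary `r = 0` at triple collision. -/
def mcGeheeLevel (C h : ℝ) : Set (EuclideanSpace ℝ (Fin 4)) :=
  {y | 0 ≤ y 0 ∧ y 2 ∈ Ioo (-(Real.pi / 2)) (Real.pi / 2) ∧ P.energyRelation C h y = 0}

/-- The triple collision manifold (over `-π/2 < θ < π/2`), common to all `h` and `C`. -/
def collisionManifold : Set (EuclideanSpace ℝ (Fin 4)) :=
  {y | y 0 = 0 ∧ y 2 ∈ Ioo (-(Real.pi / 2)) (Real.pi / 2) ∧
    (y 3) ^ 2 + (y 1) ^ 2 = 2 * P.potW (y 2)}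

/-- The point `Q* = (0, -√(2 W(0)), 0, 0)`. -/
def Qstar : EuclideanSpace ℝ (Fin 4) :=
  !₂[0, -√(2 * P.potW 0), 0, 0]

end IsoscelesParams

/-- The stable set of `q` for the flow of the vector field `X` on `S`: the points of `S` whose
forward orbit exists for all times, stays in `S` and converges to `q`. -/
def stableSet (X : EuclideanSpace ℝ (Fin 4) → EuclideanSpace ℝ (Fin 4))
    (S : Set (EuclideanSpace ℝ (Fin 4))) (q : EuclideanSpace ℝ (Fin 4)) :
    Set (EuclideanSpace ℝ (Fin 4)) :=
  {y | ∃ γ : ℝ → EuclideanSpace ℝ (Fin 4), γ 0 = y ∧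
    (∀ τ ∈ Ici (0 : ℝ), γ τ ∈ S ∧ HasDerivWithinAt γ (X (γ τ)) (Ici 0) τ) ∧
    Tendsto γ atTop (𝓝 q)}

/-- `q` is a hyperbolic sink of the vector field `X` on the three-dimensional hypersurface
`{F = 0}`: `q` is an equilibrium on the hypersurface, the tangent space `ker dF(q)` has dimension
three and is invariant under the linear part `dX(q)`, and all complex eigenvalues of `dX(q)` on
this tangent space have negative real part. -/
def IsHyperbolicSinkOn (X : EuclideanSpace ℝ (Fin 4) → EuclideanSpace ℝ (Fin 4))
    (F : EuclideanSpace ℝ (Fin 4) → ℝ) (q : EuclideanSpace ℝ (Fin 4)) : Prop :=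
  X q = 0 ∧ F q = 0 ∧ ContDiffAt ℝ 1 X q ∧ ContDiffAt ℝ 1 F q ∧
  Module.finrank ℝ (LinearMap.ker (fderiv ℝ F q).toLinearMap) = 3 ∧
  ∃ hinv : ∀ w ∈ LinearMap.ker (fderiv ℝ F q).toLinearMap,
      (fderiv ℝ X q).toLinearMap w ∈ LinearMap.ker (fderiv ℝ F q).toLinearMap,
    ∀ z : ℂ,
      ((((fderiv ℝ X q).toLinearMap.restrict hinv).charpoly).map (algebraMap ℝ ℂ)).IsRoot z →
        z.re < 0

end

/-!
The point `Q*` is a sink not only on the energy level but in the whole space `ℝ⁴` of McGehee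
coordinates: with `a = √(2 W(0))` and `k = -W''(0)` the linearization there is

  `δr' = -a δr`, `δv' = -3a δv + C² δr`, `δθ' = δu`, `δu' = -(a/2) δu - k δθ`,

and `k > 0` is exactly the condition `μ > 1 + B / (16 B₁)`. A quadratic Lyapunov function
(`exists_lyapunov_map`) and Lyapunov's theorem (`eventually_exists_forward_orbit_tendsto`) show that
all orbits starting near `Q*` exist for all `τ ≥ 0` and converge to `Q*`. The energy relation `F`
satisfies `F' = 3 v F` and `r` satisfies `r' = v r`, so these orbits stay in the energy level with
`r ≥ 0` if they start there (`stableSet_Qstar_mem_nhdsWithin`). The same linearization, restricted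
to `ker dF(Q*)` in the coordinates `(δr, δθ, δu)`, gives the hyperbolic sink on the energy level
(`isHyperbolicSinkOn_Qstar`).

Along an orbit that converges to `Q*`, `v` tends to `-a < 0`. Hence `r` decays exponentially, the
physical time `∫ r^{5/2} dτ` is finite, and the orbit, in physical time and in the original
variables, is a solution of the Hamiltonian system that ends in triple collision
(`hasDerivWithinAt_fromMcGehee`, `fromMcGehee_mem_tripleCollisionSet`).

For the surface measure, the points of `{H = h}` with `P_R < 0` form the graph of a function of
`(R, z, P_z)`. Near a point that corresponds to a point of the stable manifold of `Q*`, the whole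
graph consists of triple collision orbits. A compact piece of it projects onto a ball of `ℝ³`, and
the projection does not increase Hausdorff measure
(`exists_measurableSet_subset_tripleCollisionSet`).
-/

noncomputable section

/-! ### Sinks of vector fields -/

/-- A bounded globally Lipschitz vector field is complete: its Picard–Lindelöf solutions on the
intervals `(-a, a)` agree by uniqueness and glue to a solution on `ℝ`. -/
theorem LipschitzWith.exists_forall_hasDerivAt_of_bounded {E : Type*} [NormedAddCommGroup E]
    [NormedSpace ℝ E] [CompleteSpace E] {X : E → E} {K L : NNReal} (hX : LipschitzWith K X)
    (hL : ∀ x, ‖X x‖ ≤ L) (x₀ : E) :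
    ∃ γ : ℝ → E, γ 0 = x₀ ∧ ∀ t, HasDerivAt γ (X (γ t)) t := by
  have loc : ∀ a : ℝ, 0 < a → ∃ γ : ℝ → E, γ 0 = x₀ ∧
      ∀ t ∈ Ioo (-a) a, HasDerivAt γ (X (γ t)) t := by
    intro a ha
    have hpl : IsPicardLindelof (fun _ : ℝ => X) (tmin := -a) (tmax := a)
        ⟨0, by constructor <;> linarith⟩ x₀ (L * a.toNNReal) 0 L K := by
      refine IsPicardLindelof.of_time_independent (fun x _ => hL x) hX.lipschitzOnWith ?_
      simp [ha.le]
    obtain ⟨γ, h0, hγ⟩ := hpl.exists_eq_forall_mem_Icc_hasDerivWithinAt₀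
    exact ⟨γ, h0, fun t ht => (hγ t (Ioo_subset_Icc_self ht)).hasDerivAt
      (Icc_mem_nhds ht.1 ht.2)⟩
  choose! f hf0 hf using loc
  have key : ∀ a b : ℝ, 0 < a → a ≤ b → EqOn (f a) (f b) (Ioo (-a) a) := by
    intro a b ha hab
    refine ODE_solution_unique_of_mem_Ioo (v := fun _ => X) (s := fun _ => univ) (K := K)
      (t₀ := 0) (fun t _ => hX.lipschitzOnWith) ⟨by linarith, ha⟩
      (fun t ht => ⟨hf a ha t ht, trivial⟩)
      (fun t ht => ⟨hf b (by linarith) t ⟨by linarith [ht.1], by linarith [ht.2]⟩, trivial⟩) ?_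
    rw [hf0 a ha, hf0 b (by linarith)]
  refine ⟨fun t => f (|t| + 1) t, hf0 _ (by positivity), fun t => ?_⟩
  have hpos : 0 < |t| + 1 := by positivity
  have ht : t ∈ Ioo (-(|t| + 1)) (|t| + 1) := abs_lt.1 (by linarith)
  refine (hf _ hpos t ht).congr_of_eventuallyEq ?_
  filter_upwards [isOpen_Ioo.mem_nhds ht] with s hs
  have hs' : s ∈ Ioo (-(|s| + 1)) (|s| + 1) := abs_lt.1 (by linarith)
  rcases le_total (|s| + 1) (|t| + 1) with h | h
  · exact key _ _ (by positivity) h hs'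
  · exact (key _ _ hpos h hs).symm

/-- **Lyapunov's theorem for sinks.** If the linear part of a `C¹` vector field at an equilibrium
`q` strictly decreases the quadratic Lyapunov function `w ↦ ‖S w‖ ^ 2`, then all points near `q`
have forward orbits that exist for all times, stay in a prescribed neighbourhood of `q` and converge
to `q`. -/
theorem eventually_exists_forward_orbit_tendsto {E F : Type*} [NormedAddCommGroup E]
    [NormedSpace ℝ E] [FiniteDimensional ℝ E] [NormedAddCommGroup F] [InnerProductSpace ℝ F]
    {X : E → E} {q : E} (hX : ContDiffAt ℝ 1 X q) (hq : X q = 0) (S : E →L[ℝ] F)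
    (hS : Function.Injective S) {κ : ℝ} (hκ : 0 < κ)
    (hA : ∀ w, inner ℝ (S w) (S (fderiv ℝ X q w)) ≤ -κ * ‖S w‖ ^ 2) {U : Set E} (hU : U ∈ 𝓝 q) :
    ∀ᶠ y in 𝓝 q, ∃ γ : ℝ → E, γ 0 = y ∧
      (∀ t, 0 ≤ t → γ t ∈ U ∧ HasDerivAt γ (X (γ t)) t) ∧ Tendsto γ atTop (𝓝 q) := by
  have : CompleteSpace E := FiniteDimensional.complete ℝ E
  obtain ⟨c, hc, hS⟩ : ∃ c : ℝ, 0 < c ∧ ∀ w, c * ‖w‖ ≤ ‖S w‖ := by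
    obtain ⟨K, hK, hKS⟩ := S.toLinearMap.exists_antilipschitzWith
      (LinearMap.ker_eq_bot_of_injective hS)
    have hK' : (0 : ℝ) < K := hK
    refine ⟨(K : ℝ)⁻¹, inv_pos.2 hK', fun w => ?_⟩
    have := hKS.le_mul_dist w 0
    rw [map_zero, dist_zero_right, dist_zero_right] at this
    rw [inv_mul_eq_div, div_le_iff₀ hK', mul_comm]
    exact this
  obtain ⟨κ, hκ, hA⟩ : ∃ κ : ℝ, 0 < κ ∧
      ∀ w, inner ℝ (S w) (S (fderiv ℝ X q w)) ≤ -κ * ‖w‖ ^ 2 := by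
    refine ⟨κ * c ^ 2, by positivity, fun w => (hA w).trans ?_⟩
    have : (c * ‖w‖) ^ 2 ≤ ‖S w‖ ^ 2 := by gcongr; exact hS w
    nlinarith
  -- near `q` the Lyapunov function decreases along the nonlinear field, at half the linear rate
  have hlyap : ∀ᶠ y in 𝓝 q, inner ℝ (S (y - q)) (S (X y)) ≤ -(κ / 2) * ‖y - q‖ ^ 2 := by
    have hd := (hX.differentiableAt (by norm_num)).hasFDerivAt.isLittleO
    have hη : 0 < κ / (2 * (‖S‖ ^ 2 + 1)) := by positivity
    filter_upwards [hd.bound hη] with y hy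
    rw [hq, sub_zero] at hy
    set w := y - q
    set e := X y - fderiv ℝ X q w with he
    have h1 : X y = fderiv ℝ X q w + e := by rw [he]; abel
    have h2 : inner ℝ (S w) (S e) ≤ κ / 2 * ‖w‖ ^ 2 := by
      calc inner ℝ (S w) (S e) ≤ ‖S w‖ * ‖S e‖ := real_inner_le_norm _ _
        _ ≤ (‖S‖ * ‖w‖) * (‖S‖ * (κ / (2 * (‖S‖ ^ 2 + 1)) * ‖w‖)) := by
            gcongr
            · exact S.le_opNorm w
            · exact (S.le_opNorm e).trans (by gcongr)
        _ = κ / 2 * ‖w‖ ^ 2 * (‖S‖ ^ 2 / (‖S‖ ^ 2 + 1)) := by field_simp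
        _ ≤ κ / 2 * ‖w‖ ^ 2 * 1 := by
            gcongr
            rw [div_le_one (by positivity)]; linarith
        _ = _ := by ring
    rw [h1, map_add, inner_add_right]
    linarith [hA w]
  obtain ⟨R, hR, hball⟩ := Metric.eventually_nhds_iff_ball.1
    ((hlyap.and (hX.eventually (by norm_num))).and hU)
  set ρ := R / 3 with hρdef
  have hρ : 0 < ρ := by positivity
  -- cutting the field off outside a small ball makes it complete
  let f : ContDiffBump q := ⟨ρ, 2 * ρ, hρ, by linarith⟩
  let Y : E → E := fun y => f y • X y
  have hYc : HasCompactSupport Y := f.hasCompactSupport.smul_right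
  have hYd : ContDiff ℝ 1 Y := by
    rw [contDiff_iff_contDiffAt]
    intro y
    by_cases hy : y ∈ Metric.ball q R
    · exact f.contDiff.contDiffAt.smul (hball y hy).1.2
    · have hy' : y ∈ (Metric.closedBall q (2 * ρ))ᶜ := by
        simp only [Metric.mem_ball, mem_compl_iff, Metric.mem_closedBall, not_lt, not_le] at hy ⊢
        linarith
      refine (contDiffAt_const (c := (0 : E))).congr_of_eventuallyEq ?_
      filter_upwards [Metric.isClosed_closedBall.isOpen_compl.mem_nhds hy'] with z hz
      have : f z = 0 := f.zero_of_le_dist (by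
        simp only [mem_compl_iff, Metric.mem_closedBall, not_le] at hz; exact hz.le)
      simp [Y, this]
  have hYl : ∀ y, inner ℝ (S (y - q)) (S (Y y)) ≤ 0 := by
    intro y
    simp only [Y, map_smul, inner_smul_right]
    by_cases hy : y ∈ Metric.ball q R
    · have := (hball y hy).1.1
      exact mul_nonpos_of_nonneg_of_nonpos f.nonneg (this.trans (by
        have : 0 ≤ κ / 2 * ‖y - q‖ ^ 2 := by positivity
        linarith))
    · rw [f.zero_of_le_dist, zero_mul]
      simp only [Metric.mem_ball, not_lt] at hy
      change 2 * ρ ≤ _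
      linarith
  obtain ⟨K, hK⟩ := hYd.lipschitzWith_of_hasCompactSupport hYc (by norm_num)
  obtain ⟨C, hC⟩ := hYc.exists_bound_of_continuous hYd.continuous
  have hopen : ∀ᶠ y in 𝓝 q, ‖S (y - q)‖ < c * ρ := by
    have h1 : ContinuousAt (fun y => ‖S (y - q)‖) q := by fun_prop
    have h2 : ‖S (q - q)‖ < c * ρ := by simp; positivity
    exact h1.eventually (gt_mem_nhds h2)
  filter_upwards [hopen] with y hy
  obtain ⟨γ, h0, hγ⟩ := hK.exists_forall_hasDerivAt_of_bounded (L := C.toNNReal)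
    (fun x => (hC x).trans (Real.le_coe_toNNReal C)) y
  have hℓ : ∀ t, HasDerivAt (fun t => ‖S (γ t - q)‖ ^ 2)
      (2 * inner ℝ (S (γ t - q)) (S (Y (γ t)))) t := fun t =>
    (S.hasFDerivAt.comp_hasDerivAt t ((hγ t).sub_const q)).norm_sq
  have hanti : Antitone (fun t => ‖S (γ t - q)‖ ^ 2) :=
    antitone_of_hasDerivAt_nonpos hℓ 
      (fun t => mul_nonpos_of_nonneg_of_nonpos zero_le_two (hYl (γ t)))
  have hin : ∀ t, 0 ≤ t → ‖γ t - q‖ < ρ := by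
    intro t ht
    have h1 := hanti ht
    simp only [h0] at h1
    have h2 : ‖S (γ t - q)‖ < c * ρ := (abs_le_of_sq_le_sq' h1 (norm_nonneg _)).2.trans_lt hy
    exact lt_of_mul_lt_mul_left ((hS _).trans_lt h2) hc.le
  have hinR : ∀ t, 0 ≤ t → γ t ∈ Metric.ball q R := fun t ht => by
    rw [mem_ball_iff_norm]; linarith [hin t ht]
  have hYX : ∀ t, 0 ≤ t → Y (γ t) = X (γ t) := by
    intro t ht
    have : f (γ t) = 1 := f.one_of_mem_closedBall (by
      rw [mem_closedBall_iff_norm]; exact (hin t ht).le)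
    simp [Y, this]
  refine ⟨γ, h0, fun t ht => ⟨(hball _ (hinR t ht)).2, hYX t ht ▸ hγ t⟩, ?_⟩
  -- exponential decay of the Lyapunov function
  set lam := κ / (‖S‖ ^ 2 + 1) with hlam
  have hlam0 : 0 < lam := by positivity
  have hdec : ∀ t, 0 ≤ t → 2 * inner ℝ (S (γ t - q)) (S (Y (γ t))) ≤ -lam * ‖S (γ t - q)‖ ^ 2 := by
    intro t ht
    rw [hYX t ht]
    have h1 := (hball _ (hinR t ht)).1.1
    have h2 : ‖S (γ t - q)‖ ^ 2 ≤ (‖S‖ ^ 2 + 1) * ‖γ t - q‖ ^ 2 := by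
      calc _ ≤ (‖S‖ * ‖γ t - q‖) ^ 2 := by gcongr; exact S.le_opNorm _
        _ ≤ _ := by nlinarith [sq_nonneg ‖γ t - q‖]
    have h3 : lam * ‖S (γ t - q)‖ ^ 2 ≤ κ * ‖γ t - q‖ ^ 2 := by
      calc _ ≤ lam * ((‖S‖ ^ 2 + 1) * ‖γ t - q‖ ^ 2) := by gcongr
        _ = _ := by rw [hlam]; field_simp
    linarith
  have hmono : AntitoneOn (fun t => Real.exp (lam * t) * ‖S (γ t - q)‖ ^ 2) (Ici 0) := by
    have hd : ∀ t, HasDerivAt (fun t => Real.exp (lam * t) * ‖S (γ t - q)‖ ^ 2)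
        (Real.exp (lam * t) * (lam * 1) * ‖S (γ t - q)‖ ^ 2 +
          Real.exp (lam * t) * (2 * inner ℝ (S (γ t - q)) (S (Y (γ t))))) t := fun t =>
      (((hasDerivAt_id t).const_mul lam).exp).mul (hℓ t)
    refine antitoneOn_of_deriv_nonpos (convex_Ici 0)
      (fun t _ => (hd t).continuousAt.continuousWithinAt)
      (fun t _ => (hd t).differentiableAt.differentiableWithinAt) fun t ht => ?_
    rw [interior_Ici] at ht
    rw [(hd t).deriv]
    nlinarith [hdec t (le_of_lt ht), Real.exp_pos (lam * t)]
  have hlim : Tendsto (fun t => ‖S (γ t - q)‖ ^ 2) atTop (𝓝 0) := by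
    have hexp : Tendsto (fun t : ℝ => Real.exp (-(lam * t)) * ‖S (y - q)‖ ^ 2) atTop (𝓝 0) := by
      have : Tendsto (fun t : ℝ => lam * t) atTop atTop := tendsto_id.const_mul_atTop hlam0
      simpa using (Real.tendsto_exp_neg_atTop_nhds_zero.comp this).mul_const (‖S (y - q)‖ ^ 2)
    refine squeeze_zero' (Eventually.of_forall fun t => by positivity) ?_ hexp
    filter_upwards [eventually_ge_atTop 0] with t ht
    have h1 := hmono (mem_Ici.2 le_rfl) (mem_Ici.2 ht) ht
    simp only [h0, mul_zero, Real.exp_zero, one_mul] at h1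
    rw [Real.exp_neg, inv_mul_eq_div, le_div_iff₀ (Real.exp_pos _)]
    linarith
  rw [tendsto_iff_norm_sub_tendsto_zero]
  have h1 : Tendsto (fun t => ‖S (γ t - q)‖) atTop (𝓝 0) := by
    have := hlim.sqrt
    simpa [Real.sqrt_sq] using this
  refine squeeze_zero (fun t => norm_nonneg _) (fun t => ?_) (by simpa using h1.const_mul c⁻¹)
  rw [inv_mul_eq_div, le_div_iff₀ hc, mul_comm]
  simpa only [map_sub] using hS (γ t - q)

namespace IsoscelesParams

variable {P : IsoscelesParams}

/-! ### The potentials -/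

theorem mu_pos (hM : 0 < P.M) (hm : 0 < P.m) : 0 < P.mu := by
  unfold mu; positivity

theorem cos_sq_add_mu_mul_sin_sq_pos (hmu : 0 < P.mu) (θ : ℝ) :
    0 < Real.cos θ ^ 2 + P.mu * Real.sin θ ^ 2 := by
  rcases eq_or_ne (Real.sin θ) 0 with h | h
  · have := Real.sin_sq_add_cos_sq θ
    rw [h] at this ⊢
    nlinarith
  · positivity

theorem hasDerivAt_sqrt_cos_sq_add (hmu : 0 < P.mu) (θ : ℝ) :
    HasDerivAt (fun θ => √(Real.cos θ ^ 2 + P.mu * Real.sin θ ^ 2))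
      ((P.mu - 1) * Real.sin θ * Real.cos θ / √(Real.cos θ ^ 2 + P.mu * Real.sin θ ^ 2)) θ := by
  have h := (((Real.hasDerivAt_cos θ).pow 2).add
    (((Real.hasDerivAt_sin θ).pow 2).const_mul P.mu)).sqrt
      (cos_sq_add_mu_mul_sin_sq_pos hmu θ).ne'
  convert! h using 1
  field_simp
  push_cast
  simp
  ring

theorem hasDerivAt_potV (hmu : 0 < P.mu) {θ : ℝ} (hθ : 0 < Real.cos θ) :
    HasDerivAt P.potV (√(P.M / 2) * (P.A * Real.sin θ / Real.cos θ ^ 2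
      - 4 * P.A₁ * (P.mu - 1) * Real.sin θ * Real.cos θ /
        √(Real.cos θ ^ 2 + P.mu * Real.sin θ ^ 2) ^ 3)) θ := by
  have hD : 0 < √(Real.cos θ ^ 2 + P.mu * Real.sin θ ^ 2) :=
    Real.sqrt_pos.2 (cos_sq_add_mu_mul_sin_sq_pos hmu θ)
  have h := (((hasDerivAt_const θ P.A).div (Real.hasDerivAt_cos θ) hθ.ne').add
    ((hasDerivAt_const θ (4 * P.A₁)).div (hasDerivAt_sqrt_cos_sq_add hmu θ) hD.ne')).const_mul
      √(P.M / 2)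
  convert! h using 1
  set D := √(Real.cos θ ^ 2 + P.mu * Real.sin θ ^ 2)
  field_simp
  ring

theorem hasDerivAt_potW (hmu : 0 < P.mu) {θ : ℝ} (hθ : 0 < Real.cos θ) :
    HasDerivAt P.potW (√(P.M / 2) ^ 3 * (3 * P.B * Real.sin θ / Real.cos θ ^ 4
      - 48 * P.B₁ * (P.mu - 1) * Real.sin θ * Real.cos θ /
        √(Real.cos θ ^ 2 + P.mu * Real.sin θ ^ 2) ^ 5)) θ := by
  have hD : 0 < √(Real.cos θ ^ 2 + P.mu * Real.sin θ ^ 2) :=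
    Real.sqrt_pos.2 (cos_sq_add_mu_mul_sin_sq_pos hmu θ)
  have h := (((hasDerivAt_const θ P.B).div ((Real.hasDerivAt_cos θ).pow 3)
      (pow_pos hθ 3).ne').add ((hasDerivAt_const θ (16 * P.B₁)).div
        ((hasDerivAt_sqrt_cos_sq_add hmu θ).pow 3) (pow_pos hD 3).ne')).const_mul (√(P.M / 2) ^ 3)
  convert! h using 1
  simp only [Pi.pow_apply]
  set D := √(Real.cos θ ^ 2 + P.mu * Real.sin θ ^ 2)
  field_simp
  ring

theorem _root_.eventually_cos_pos : ∀ᶠ θ in 𝓝 (0 : ℝ), 0 < Real.cos θ :=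
  Real.continuous_cos.continuousAt.eventually (lt_mem_nhds (by simp))

theorem deriv_potV_eventuallyEq (hmu : 0 < P.mu) :
    deriv P.potV =ᶠ[𝓝 0] fun θ => √(P.M / 2) * (P.A * Real.sin θ / Real.cos θ ^ 2
      - 4 * P.A₁ * (P.mu - 1) * Real.sin θ * Real.cos θ /
        √(Real.cos θ ^ 2 + P.mu * Real.sin θ ^ 2) ^ 3) := by
  filter_upwards [eventually_cos_pos] with θ hθ using (hasDerivAt_potV hmu hθ).deriv

theorem deriv_potW_eventuallyEq (hmu : 0 < P.mu) :
    deriv P.potW =ᶠ[𝓝 0] fun θ => √(P.M / 2) ^ 3 * (3 * P.B * Real.sin θ / Real.cos θ ^ 4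
      - 48 * P.B₁ * (P.mu - 1) * Real.sin θ * Real.cos θ /
        √(Real.cos θ ^ 2 + P.mu * Real.sin θ ^ 2) ^ 5) := by
  filter_upwards [eventually_cos_pos] with θ hθ using (hasDerivAt_potW hmu hθ).deriv

theorem contDiffAt_sqrt_cos_sq_add :
    ContDiffAt ℝ 1 (fun θ => √(Real.cos θ ^ 2 + P.mu * Real.sin θ ^ 2)) 0 :=
  ContDiffAt.sqrt (by fun_prop) (by simp)

theorem contDiffAt_potV : ContDiffAt ℝ 1 P.potV 0 := by
  have h := contDiffAt_sqrt_cos_sq_add (P := P)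
  unfold potV
  fun_prop (disch := simp)

theorem contDiffAt_potW : ContDiffAt ℝ 1 P.potW 0 := by
  have h := contDiffAt_sqrt_cos_sq_add (P := P)
  unfold potW
  fun_prop (disch := simp)

theorem contDiffAt_deriv_potV (hmu : 0 < P.mu) : ContDiffAt ℝ 1 (deriv P.potV) 0 := by
  have h := contDiffAt_sqrt_cos_sq_add (P := P)
  refine ContDiffAt.congr_of_eventuallyEq ?_ (deriv_potV_eventuallyEq hmu)
  fun_prop (disch := simp)

theorem contDiffAt_deriv_potW (hmu : 0 < P.mu) : ContDiffAt ℝ 1 (deriv P.potW) 0 := by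
  have h := contDiffAt_sqrt_cos_sq_add (P := P)
  refine ContDiffAt.congr_of_eventuallyEq ?_ (deriv_potW_eventuallyEq hmu)
  fun_prop (disch := simp)

theorem deriv_potV_zero (hmu : 0 < P.mu) : deriv P.potV 0 = 0 := by
  rw [(hasDerivAt_potV hmu (by simp)).deriv]; simp

theorem deriv_potW_zero (hmu : 0 < P.mu) : deriv P.potW 0 = 0 := by
  rw [(hasDerivAt_potW hmu (by simp)).deriv]; simp

/-- The value `-W''(0)`, the stiffness of the linearized motion in `θ` at `Q*`. -/
def stiffness (P : IsoscelesParams) : ℝ :=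
  √(P.M / 2) ^ 3 * (48 * P.B₁ * (P.mu - 1) - 3 * P.B)

/-- The lower bound on the mass ratio says exactly that `W` has a nondegenerate maximum at `0`. -/
theorem stiffness_pos (hM : 0 < P.M) (hB₁ : 0 < P.B₁)
    (hmuB : 1 + P.B / (16 * P.B₁) < P.mu) : 0 < P.stiffness := by
  have h : P.B < (P.mu - 1) * (16 * P.B₁) := by
    rw [← div_lt_iff₀ (by positivity)]; linarith
  have : 0 < √(P.M / 2) := Real.sqrt_pos.2 (by positivity)
  exact mul_pos (by positivity) (by linarith)

theorem hasDerivAt_deriv_potW_zero (hmu : 0 < P.mu) :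
    HasDerivAt (deriv P.potW) (-P.stiffness) 0 := by
  refine HasDerivAt.congr_of_eventuallyEq ?_ (deriv_potW_eventuallyEq hmu)
  -- the derivative has the form `sin θ * g θ`, so that its derivative at `0` is `g 0`
  have h := contDiffAt_sqrt_cos_sq_add (P := P)
  have hg : DifferentiableAt ℝ (fun θ => √(P.M / 2) ^ 3 * (3 * P.B / Real.cos θ ^ 4
      - 48 * P.B₁ * (P.mu - 1) * Real.cos θ /
        √(Real.cos θ ^ 2 + P.mu * Real.sin θ ^ 2) ^ 5)) 0 := by
    refine ContDiffAt.differentiableAt (n := 1) ?_ (by norm_num)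
    fun_prop (disch := simp)
  convert! (Real.hasDerivAt_sin 0).mul hg.hasDerivAt using 1
  · ext θ
    simp only [Pi.mul_apply]
    ring
  · simp [stiffness]
    ring

theorem potW_zero_pos (hM : 0 < P.M) (hB : 0 < P.B) (hB₁ : 0 < P.B₁) : 0 < P.potW 0 := by
  have : 0 < √(P.M / 2) := Real.sqrt_pos.2 (by positivity)
  simp [potW]
  positivity

/-! ### The linearization at `Q*` -/

/-- The speed `√(2 W(0))`, so that `Q* = (0, -collisionSpeed, 0, 0)`. -/
def collisionSpeed (P : IsoscelesParams) : ℝ := √(2 * P.potW 0)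

theorem collisionSpeed_pos (hW0 : 0 < P.potW 0) : 0 < P.collisionSpeed :=
  Real.sqrt_pos.2 (by positivity)

theorem collisionSpeed_sq (hW0 : 0 < P.potW 0) : P.collisionSpeed ^ 2 = 2 * P.potW 0 :=
  Real.sq_sqrt (by positivity)

theorem Qstar_eq : P.Qstar = !₂[0, -P.collisionSpeed, 0, 0] := rfl

theorem contDiffAt_potential_comp_coord {f : ℝ → ℝ} (hf : ContDiffAt ℝ 1 f 0) :
    ContDiffAt ℝ 1 (fun y : EuclideanSpace ℝ (Fin 4) => f (y 2)) P.Qstar :=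
  ContDiffAt.comp P.Qstar (by simpa [Qstar_eq] using hf) (by fun_prop)

theorem contDiffAt_mcGeheeField (hmu : 0 < P.mu) (C : ℝ) :
    ContDiffAt ℝ 1 (P.mcGeheeField C) P.Qstar := by
  have h1 := contDiffAt_potential_comp_coord (P := P) (contDiffAt_potV (P := P))
  have h2 := contDiffAt_potential_comp_coord (P := P) (contDiffAt_potW (P := P))
  have h3 := contDiffAt_potential_comp_coord (P := P) (contDiffAt_deriv_potV hmu)
  have h4 := contDiffAt_potential_comp_coord (P := P) (contDiffAt_deriv_potW hmu)
  have hc : Real.cos (P.Qstar 2) ≠ 0 := by simp [Qstar_eq]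
  have hc2 : Real.cos (P.Qstar 2) ^ 2 ≠ 0 := pow_ne_zero 2 hc
  have hc3 : Real.cos (P.Qstar 2) ^ 3 ≠ 0 := pow_ne_zero 3 hc
  rw [contDiffAt_euclidean]
  intro i
  fin_cases i
  · simp [mcGeheeField]; fun_prop
  · simp [mcGeheeField]; fun_prop (disch := assumption)
  · simp [mcGeheeField]; fun_prop
  · simp [mcGeheeField]; fun_prop (disch := assumption)

theorem contDiffAt_energyRelation (C h : ℝ) :
    ContDiffAt ℝ 1 (P.energyRelation C h) P.Qstar := by
  have h1 := contDiffAt_potential_comp_coord (P := P) (contDiffAt_potV (P := P))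
  have h2 := contDiffAt_potential_comp_coord (P := P) (contDiffAt_potW (P := P))
  have hc : Real.cos (P.Qstar 2) ≠ 0 := by simp [Qstar_eq]
  have hc2 : 2 * Real.cos (P.Qstar 2) ^ 2 ≠ 0 := mul_ne_zero two_ne_zero (pow_ne_zero 2 hc)
  unfold energyRelation
  fun_prop (disch := assumption)

/-- The derivative of `t ↦ f (q + t • w)` at `0` computes the Fréchet derivative of `f`. -/
theorem _root_.fderiv_apply_eq_of_hasDerivAt_line {E F : Type*} [NormedAddCommGroup E]
    [NormedSpace ℝ E] [NormedAddCommGroup F] [NormedSpace ℝ F] {f : E → F} {q w : E} {d : F}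
    (hf : DifferentiableAt ℝ f q) (hd : HasDerivAt (fun t : ℝ => f (q + t • w)) d 0) :
    fderiv ℝ f q w = d := by
  have h : HasDerivAt (fun t : ℝ => q + t • w) w 0 := by
    simpa using ((hasDerivAt_id (0 : ℝ)).smul_const w).const_add q
  have hf' : HasFDerivAt f (fderiv ℝ f q) (q + (0 : ℝ) • w) := by simpa using hf.hasFDerivAt
  exact (hf'.comp_hasDerivAt 0 h).unique hd

theorem _root_.hasDerivWithinAt_euclidean {ι : Type*} [Fintype ι] {γ : ℝ → EuclideanSpace ℝ ι}
    {γ' : EuclideanSpace ℝ ι} {s : Set ℝ} {t : ℝ} :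
    HasDerivWithinAt γ γ' s t ↔ ∀ i, HasDerivWithinAt (fun t => γ t i) (γ' i) s t := by
  simp only [hasDerivWithinAt_iff_hasFDerivWithinAt]
  rw [hasFDerivWithinAt_euclidean]
  refine forall_congr' fun i => ?_
  have h : PiLp.proj (𝕜 := ℝ) 2 (fun _ : ι => ℝ) i ∘L ContinuousLinearMap.toSpanSingleton ℝ γ'
      = ContinuousLinearMap.toSpanSingleton ℝ (γ' i) := by ext; simp
  exact h ▸ Iff.rfl

theorem _root_.hasDerivAt_comp_mul_const {f : ℝ → ℝ} {d : ℝ} (hf : HasDerivAt f d 0) (c : ℝ) :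
    HasDerivAt (fun t => f (t * c)) (d * c) 0 := by
  have hl : HasDerivAt (fun t : ℝ => t * c) c 0 := by
    simpa using (hasDerivAt_id (0 : ℝ)).mul_const c
  exact HasDerivAt.comp (h₂ := f) (0 : ℝ) (by simpa using hf) hl

theorem hasDerivAt_potV_zero (hmu : 0 < P.mu) : HasDerivAt P.potV 0 0 := by
  simpa [deriv_potV_zero hmu] using
    ((contDiffAt_potV (P := P)).differentiableAt (by norm_num)).hasDerivAt

theorem hasDerivAt_potW_zero (hmu : 0 < P.mu) : HasDerivAt P.potW 0 0 := by
  simpa [deriv_potW_zero hmu] using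
    ((contDiffAt_potW (P := P)).differentiableAt (by norm_num)).hasDerivAt

theorem fderiv_energyRelation_apply (hmu : 0 < P.mu) (C h : ℝ) (w : EuclideanSpace ℝ (Fin 4)) :
    fderiv ℝ (P.energyRelation C h) P.Qstar w
      = -P.collisionSpeed * w 1 + C ^ 2 / 2 * w 0 := by
  refine fderiv_apply_eq_of_hasDerivAt_line
    ((contDiffAt_energyRelation C h).differentiableAt (by norm_num)) ?_
  set a := P.collisionSpeed with ha
  have hl : ∀ c : ℝ, HasDerivAt (fun t : ℝ => t * c) c 0 := fun c => by
    simpa using (hasDerivAt_id (0 : ℝ)).mul_const c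
  have hV := hasDerivAt_comp_mul_const (hasDerivAt_potV_zero hmu) (w 2)
  have hW := hasDerivAt_comp_mul_const (hasDerivAt_potW_zero hmu) (w 2)
  have hcos := ((((hl (w 2)).cos).pow 2).const_mul 2)
  have hcent := (hasDerivAt_const (0 : ℝ) (C ^ 2)).div hcos (by simp)
  have key := ((((((hl (w 3)).pow 2).add (((hl (w 1)).const_add (-a)).pow 2)).const_mul (1 / 2)).add
    (hcent.mul (hl (w 0)))).sub (((hl (w 0)).pow 2).mul hV)).sub hW |>.sub
      (((hl (w 0)).pow 3).const_mul h)
  convert! key using 1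
  · ext t
    simp [energyRelation, Qstar_eq, ha]
  · simp
    ring

/-- The linearized equations of motion at `Q*`. The terms with `V` drop out, as they carry a
factor `r²`. -/
theorem fderiv_mcGeheeField_apply (hmu : 0 < P.mu) (C : ℝ)
    (w : EuclideanSpace ℝ (Fin 4)) :
    fderiv ℝ (P.mcGeheeField C) P.Qstar w
      = !₂[-P.collisionSpeed * w 0, -(3 * P.collisionSpeed) * w 1 + C ^ 2 * w 0, w 3,
          -(P.collisionSpeed / 2) * w 3 - P.stiffness * w 2] := by
  refine fderiv_apply_eq_of_hasDerivAt_line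
    ((contDiffAt_mcGeheeField hmu C).differentiableAt (by norm_num)) ?_
  set a := P.collisionSpeed with ha
  have hl : ∀ c : ℝ, HasDerivAt (fun t : ℝ => t * c) c 0 := fun c => by
    simpa using (hasDerivAt_id (0 : ℝ)).mul_const c
  have hV := hasDerivAt_comp_mul_const (hasDerivAt_potV_zero hmu) (w 2)
  have hW := hasDerivAt_comp_mul_const (hasDerivAt_potW_zero hmu) (w 2)
  have hV' := hasDerivAt_comp_mul_const
    ((contDiffAt_deriv_potV hmu).differentiableAt (by norm_num)).hasDerivAt (w 2)
  have hW' := hasDerivAt_comp_mul_const (hasDerivAt_deriv_potW_zero hmu) (w 2)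
  have hcos2 := (((hl (w 2)).cos).pow 2)
  have hcos3 := (((hl (w 2)).cos).pow 3)
  have hv := (hl (w 1)).const_add (-a)
  rw [← hasDerivWithinAt_univ, hasDerivWithinAt_euclidean]
  intro i
  rw [hasDerivWithinAt_univ]
  fin_cases i
  · convert! (hl (w 0)).mul hv using 1
    · ext t; simp [mcGeheeField, Qstar_eq, ha]
    · simp; ring
  · convert! ((((hv.pow 2).const_mul (3 / 2)).add ((hl (w 3)).pow 2)).add
      (((hasDerivAt_const (0 : ℝ) (C ^ 2)).div hcos2 (by simp)).mul (hl (w 0)))).sub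
        (((hl (w 0)).pow 2).mul hV) |>.sub (hW.const_mul 3) using 1
    · ext t; simp [mcGeheeField, Qstar_eq, ha]
    · simp; ring
  · convert! hl (w 3) using 1
    ext t; simp [mcGeheeField, Qstar_eq]
  · convert! ((((hl (w 3)).mul hv).const_mul (1 / 2)).sub
      (((((hl (w 2)).sin).div hcos3 (by simp)).const_mul (C ^ 2)).mul (hl (w 0)))).add
        (((hl (w 0)).pow 2).mul hV') |>.add hW' using 1
    · ext t; simp [mcGeheeField, Qstar_eq, ha]
    · simp; ring

theorem mcGeheeField_Qstar (hmu : 0 < P.mu) (hW0 : 0 < P.potW 0) (C : ℝ) :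
    P.mcGeheeField C P.Qstar = 0 := by
  have h2 : P.collisionSpeed ^ 2 = 2 * P.potW 0 := collisionSpeed_sq hW0
  ext i
  fin_cases i <;> simp [mcGeheeField, Qstar_eq, deriv_potW_zero hmu]
  rw [h2]; ring

theorem energyRelation_Qstar (hW0 : 0 < P.potW 0) (C h : ℝ) :
    P.energyRelation C h P.Qstar = 0 := by
  have h2 : P.collisionSpeed ^ 2 = 2 * P.potW 0 := collisionSpeed_sq hW0
  simp [energyRelation, Qstar_eq]
  rw [h2]; ring

theorem Qstar_mem_collisionManifold (hW0 : 0 < P.potW 0) : P.Qstar ∈ P.collisionManifold := by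
  have h2 : P.collisionSpeed ^ 2 = 2 * P.potW 0 := collisionSpeed_sq hW0
  refine ⟨by simp [Qstar_eq], by simp [Qstar_eq, Real.pi_pos], ?_⟩
  simp [Qstar_eq]
  rw [h2]

/-- The tangent space of the energy level at `Q*` is the graph of `δv = C² / (2a) δr` over the
coordinates `(δr, δθ, δu)`, where `a = √(2 W(0))`. -/
def tangentEquiv (hmu : 0 < P.mu) (hW0 : 0 < P.potW 0) (C h : ℝ) :
    LinearMap.ker (fderiv ℝ (P.energyRelation C h) P.Qstar).toLinearMap ≃ₗ[ℝ] (Fin 3 → ℝ) where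
  toFun w := ![w.1 0, w.1 2, w.1 3]
  invFun x := ⟨!₂[x 0, C ^ 2 / (2 * P.collisionSpeed) * x 0, x 1, x 2], by
    have : 0 < P.collisionSpeed := collisionSpeed_pos hW0
    simp only [LinearMap.mem_ker, ContinuousLinearMap.coe_coe, fderiv_energyRelation_apply hmu]
    generalize P.collisionSpeed = a at *
    simp
    field_simp
    ring⟩
  map_add' w w' := by ext i; fin_cases i <;> simp
  map_smul' t w := by ext i; fin_cases i <;> simp
  left_inv w := by
    have ha : 0 < P.collisionSpeed := collisionSpeed_pos hW0
    have hw := w.2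
    simp only [LinearMap.mem_ker, ContinuousLinearMap.coe_coe,
      fderiv_energyRelation_apply hmu] at hw
    ext i
    fin_cases i <;> simp
    generalize P.collisionSpeed = a at *
    field_simp
    linarith
  right_inv x := by ext i; fin_cases i <;> simp

/-- The linearization at `Q*` on the tangent space of the energy level, in the coordinates
`(δr, δθ, δu)`: a contraction in `δr` and a damped oscillator in `(δθ, δu)`. -/
def tangentMatrix (P : IsoscelesParams) : Matrix (Fin 3) (Fin 3) ℝ :=
  !![-P.collisionSpeed, 0, 0; 0, 0, 1; 0, -P.stiffness, -(P.collisionSpeed / 2)]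

theorem isHyperbolicSinkOn_Qstar (hmu : 0 < P.mu) (hW0 : 0 < P.potW 0) (hk : 0 < P.stiffness)
    (C h : ℝ) : IsHyperbolicSinkOn (P.mcGeheeField C) (P.energyRelation C h) P.Qstar := by
  have ha : 0 < P.collisionSpeed := collisionSpeed_pos hW0
  have hinv : ∀ w ∈ LinearMap.ker (fderiv ℝ (P.energyRelation C h) P.Qstar).toLinearMap,
      (fderiv ℝ (P.mcGeheeField C) P.Qstar).toLinearMap w ∈
        LinearMap.ker (fderiv ℝ (P.energyRelation C h) P.Qstar).toLinearMap := by
    intro w hw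
    simp only [LinearMap.mem_ker, ContinuousLinearMap.coe_coe, fderiv_energyRelation_apply hmu,
      fderiv_mcGeheeField_apply hmu] at hw ⊢
    generalize P.collisionSpeed = a at *
    simp
    linear_combination (-3 * a) * hw
  refine ⟨mcGeheeField_Qstar hmu hW0 C, energyRelation_Qstar hW0 C h,
    contDiffAt_mcGeheeField hmu C, contDiffAt_energyRelation C h, ?_, hinv, fun z hz => ?_⟩
  · rw [(tangentEquiv hmu hW0 C h).finrank_eq]; simp
  · have hconj : (tangentEquiv hmu hW0 C h).conj
        ((fderiv ℝ (P.mcGeheeField C) P.Qstar).toLinearMap.restrict hinv)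
          = P.tangentMatrix.toLin' := by
      ext x i
      fin_cases x <;> fin_cases i <;>
      simp [LinearEquiv.conj_apply, tangentEquiv, fderiv_mcGeheeField_apply hmu, tangentMatrix,
        LinearMap.restrict_apply]
    rw [← LinearEquiv.charpoly_conj (tangentEquiv hmu hW0 C h), hconj, Matrix.charpoly_toLin'] at hz
    set a := P.collisionSpeed with hadef
    have hz' : (z + a) * (z * (z + a / 2) + P.stiffness) = 0 := by
      simp [tangentMatrix, Matrix.charpoly, Matrix.charmatrix, Matrix.det_fin_three,
        Polynomial.IsRoot, ← hadef] at hz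
      linear_combination hz
    rcases mul_eq_zero.1 hz' with h1 | h1
    · have := congrArg Complex.re h1
      simp at this
      linarith
    -- the eigenvalues of the oscillator have real part `-a/4` if they are not real; a real one
    -- cannot be nonnegative, as the stiffness is positive
    · have hre := congrArg Complex.re h1
      have him := congrArg Complex.im h1
      simp at hre him
      have him' : z.im * (2 * z.re + a / 2) = 0 := by linarith
      rcases mul_eq_zero.1 him' with h2 | h2
      · rw [h2] at hre
        by_contra hneg
        push Not at hneg
        have : 0 ≤ z.re * (z.re + a / 2) := by positivity
        linarith
      · linarith

/-! ### Invariance of the energy level and the stable manifold of `Q*` -/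

/-- A solution of a scalar linear equation `f' = g f` keeps the sign of its initial value. -/
theorem _root_.exists_eq_mul_exp_of_hasDerivWithinAt {f g : ℝ → ℝ} (hg : ContinuousOn g (Ici 0))
    (hf : ∀ τ ∈ Ici (0 : ℝ), HasDerivWithinAt f (g τ * f τ) (Ici 0) τ) :
    ∃ G : ℝ → ℝ, ∀ τ ∈ Ici (0 : ℝ), f τ = f 0 * Real.exp (G τ) := by
  have hg' : Continuous fun τ => g (max τ 0) :=
    hg.comp_continuous (by fun_prop) fun τ => le_max_right τ 0
  refine ⟨fun τ => ∫ s in (0 : ℝ)..τ, g (max s 0), fun τ hτ => ?_⟩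
  set G : ℝ → ℝ := fun τ => ∫ s in (0 : ℝ)..τ, g (max s 0) with hG
  have hGd : ∀ τ, HasDerivAt G (g (max τ 0)) τ := fun τ =>
    intervalIntegral.integral_hasDerivAt_right (hg'.intervalIntegrable _ _)
      hg'.stronglyMeasurable.stronglyMeasurableAtFilter hg'.continuousAt
  have hd : ∀ x ∈ Ici (0 : ℝ), HasDerivWithinAt (fun τ => f τ * Real.exp (-G τ)) 0 (Ici 0) x := by
    intro x hx
    convert! (hf x hx).mul ((hGd x).neg.exp).hasDerivWithinAt using 1
    rw [max_eq_left hx]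
    ring
  have := constant_of_has_deriv_right_zero (a := 0) (b := τ)
    (fun x hx => ((hd x hx.1).continuousWithinAt).mono Icc_subset_Ici_self)
    (fun x hx => (hd x hx.1).mono (Ici_subset_Ici.2 hx.1)) τ ⟨hτ, le_rfl⟩
  have hG0 : G 0 = 0 := by simp [hG]
  simp only [hG0, neg_zero, Real.exp_zero, mul_one] at this
  rw [← this, mul_assoc, ← Real.exp_add]
  simp

theorem cos_pos_of_mem_mcGeheeLevel {C h : ℝ} {y : EuclideanSpace ℝ (Fin 4)}
    (hy : y ∈ P.mcGeheeLevel C h) : 0 < Real.cos (y 2) :=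
  Real.cos_pos_of_mem_Ioo hy.2.1

/-- The energy relation is `r³` times the energy difference, hence satisfies `F' = 3 v F`. -/
theorem hasDerivWithinAt_energyRelation (hmu : 0 < P.mu) {C : ℝ} (h : ℝ)
    {γ : ℝ → EuclideanSpace ℝ (Fin 4)} {s : Set ℝ} {τ : ℝ} (hcos : 0 < Real.cos (γ τ 2))
    (hγ : HasDerivWithinAt γ (P.mcGeheeField C (γ τ)) s τ) :
    HasDerivWithinAt (fun τ => P.energyRelation C h (γ τ))
      (3 * γ τ 1 * P.energyRelation C h (γ τ)) s τ := by
  rw [hasDerivWithinAt_euclidean] at hγ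
  have h0 := hγ 0
  have h1 := hγ 1
  have h2 := hγ 2
  have h3 := hγ 3
  have hV : HasDerivWithinAt (fun τ => P.potV (γ τ 2)) _ s τ :=
    HasDerivAt.comp_hasDerivWithinAt (h₂ := P.potV) τ
      (hasDerivAt_potV hmu hcos).differentiableAt.hasDerivAt h2
  have hW : HasDerivWithinAt (fun τ => P.potW (γ τ 2)) _ s τ :=
    HasDerivAt.comp_hasDerivWithinAt (h₂ := P.potW) τ
      (hasDerivAt_potW hmu hcos).differentiableAt.hasDerivAt h2
  have hcent := (hasDerivWithinAt_const τ s (C ^ 2)).div ((h2.cos.pow 2).const_mul 2)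
    (mul_ne_zero two_ne_zero (pow_ne_zero 2 hcos.ne'))
  have key := (((((h3.pow 2).add (h1.pow 2)).const_mul (1 / 2)).add (hcent.mul h0)).sub
    ((h0.pow 2).mul hV)).sub hW |>.sub ((h0.pow 3).const_mul h)
  convert! key using 1
  simp [energyRelation, mcGeheeField]
  field_simp
  ring

/-- The linearization at `Q*` contracts in all directions of `ℝ⁴`, also across the energy level. In
the Lyapunov function, `N r² + (δv)²` with large `N` dominates the coupling `C²` of `r` and `δv`,
and `(k - ε²) θ² + (u + ε θ)²` with small `ε` is decreased by the damped oscillator. -/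
theorem exists_lyapunov_map (hmu : 0 < P.mu) (hW0 : 0 < P.potW 0) (hk : 0 < P.stiffness) (C : ℝ) :
    ∃ S : EuclideanSpace ℝ (Fin 4) →L[ℝ] EuclideanSpace ℝ (Fin 4), Function.Injective S ∧
      ∃ κ : ℝ, 0 < κ ∧ ∀ w, inner ℝ (S w) (S (fderiv ℝ (P.mcGeheeField C) P.Qstar w))
        ≤ -κ * ‖S w‖ ^ 2 := by
  simp only [fderiv_mcGeheeField_apply hmu]
  have ha : 0 < P.collisionSpeed := collisionSpeed_pos hW0
  generalize P.collisionSpeed = a at *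
  generalize P.stiffness = k at *
  obtain ⟨c, rfl⟩ : ∃ c, a = 2 * c := ⟨a / 2, by ring⟩
  have hc : 0 < c := by linarith
  set ε := k * c / (4 * (k + c ^ 2)) with hε
  have hε0 : 0 < ε := by positivity
  have hεc : ε ≤ c / 4 := by
    rw [hε, div_le_div_iff₀ (by positivity) (by positivity)]
    nlinarith [pow_pos hc 3]
  have hεc' : ε * c ≤ k / 4 := by
    rw [hε, div_mul_eq_mul_div, div_le_div_iff₀ (by positivity) (by positivity)]
    nlinarith [mul_pos hk hk]
  have hm : 2 * (ε * c) ≤ k - ε ^ 2 := by nlinarith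
  set m := k - ε ^ 2 with hmdef
  have hm0 : 0 < m := lt_of_lt_of_le (by positivity) hm
  set N := 1 + C ^ 4 / (2 * c) ^ 2 with hN
  have hN0 : 0 < N := by positivity
  let S : EuclideanSpace ℝ (Fin 4) →ₗ[ℝ] EuclideanSpace ℝ (Fin 4) :=
    { toFun := fun w => !₂[√N * w 0, w 1, √m * w 2, w 3 + ε * w 2]
      map_add' := fun w w' => by ext i; fin_cases i <;> simp <;> ring
      map_smul' := fun t w => by ext i; fin_cases i <;> simp <;> ring }
  refine ⟨S.toContinuousLinearMap, ?_, ε / 2, by positivity, fun w => ?_⟩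
  · rw [injective_iff_map_eq_zero]
    intro w hw
    have h0 := congrArg (fun x : EuclideanSpace ℝ (Fin 4) => x 0) hw
    have h1 := congrArg (fun x : EuclideanSpace ℝ (Fin 4) => x 1) hw
    have h2 := congrArg (fun x : EuclideanSpace ℝ (Fin 4) => x 2) hw
    have h3 := congrArg (fun x : EuclideanSpace ℝ (Fin 4) => x 3) hw
    simp [S, (Real.sqrt_pos.2 hN0).ne', (Real.sqrt_pos.2 hm0).ne'] at h0 h1 h2 h3
    rw [h2] at h3
    ext i
    fin_cases i <;> simp [*]
    linarith
  · rw [EuclideanSpace.norm_sq_eq]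
    simp only [S, LinearMap.coe_toContinuousLinearMap', LinearMap.coe_mk, AddHom.coe_mk,
      Fin.sum_univ_four, PiLp.inner_apply]
    simp [mul_pow, Real.sq_sqrt hN0.le, Real.sq_sqrt hm0.le]
    have hN2 := Real.mul_self_sqrt hN0.le
    have hm2 := Real.mul_self_sqrt hm0.le
    generalize √N = n at *
    generalize √m = l at *
    have e1 : C ^ 2 * w 0 * w 1 ≤ c * (N * w 0 ^ 2 + w 1 ^ 2) := by
      have : c * (N * w 0 ^ 2 + w 1 ^ 2) - C ^ 2 * w 0 * w 1
          = c * w 0 ^ 2 + (C ^ 2 * w 0 - 2 * c * w 1) ^ 2 / (4 * c) := by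
        rw [hN]; field_simp; ring
      have : 0 ≤ c * w 0 ^ 2 + (C ^ 2 * w 0 - 2 * c * w 1) ^ 2 / (4 * c) := by positivity
      linarith
    obtain ⟨p, hp⟩ : ∃ p, p = w 3 + ε * w 2 := ⟨_, rfl⟩
    have hw3 : w 3 = p - ε * w 2 := by linarith
    have e2 : (ε * c - 2 * ε ^ 2) * (w 2 * p) ≤ ε * m / 2 * w 2 ^ 2 + c / 4 * p ^ 2 := by
      have hq : (ε * c - 2 * ε ^ 2) ^ 2 ≤ ε * m * c / 2 := by
        have h1 : 0 ≤ ε * c - 2 * ε ^ 2 := by nlinarith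
        have h2 : ε * c - 2 * ε ^ 2 ≤ ε * c := by nlinarith
        have h3 : (ε * c - 2 * ε ^ 2) ^ 2 ≤ (ε * c) ^ 2 := by gcongr
        have h4 : (ε * c) * (2 * (ε * c)) ≤ (ε * c) * m := by gcongr
        nlinarith
      generalize ε * c - 2 * ε ^ 2 = q at *
      refine le_of_mul_le_mul_left ?_ hc
      have : q ^ 2 * w 2 ^ 2 ≤ ε * m * c / 2 * w 2 ^ 2 := by gcongr
      nlinarith [sq_nonneg (c / 2 * p - q * w 2)]
    rw [hw3]
    have key : ε / 2 * (N * w 0 ^ 2 + w 1 ^ 2 + m * w 2 ^ 2 + p ^ 2)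
        + N * w 0 * (-(2 * c) * w 0) + w 1 * (-(3 * (2 * c)) * w 1 + C ^ 2 * w 0)
        + m * w 2 * (p - ε * w 2) + p * (-c * (p - ε * w 2) - k * w 2 + ε * (p - ε * w 2)) ≤ 0 := by
      have hk' : k = m + ε ^ 2 := by rw [hmdef]; ring
      have i1 : ε / 2 * (N * w 0 ^ 2) ≤ c * (N * w 0 ^ 2) := by gcongr; linarith
      have i2 : ε / 2 * w 1 ^ 2 ≤ c * w 1 ^ 2 := by gcongr; linarith
      have i3 : (ε / 2 + ε) * p ^ 2 ≤ 3 / 4 * c * p ^ 2 := by gcongr; linarith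
      rw [hk']
      have j1 : 0 ≤ c * w 1 ^ 2 := by positivity
      nlinarith
    refine le_of_sub_nonpos (le_trans (le_of_eq ?_) key)
    linear_combination (-(2 * c) * w 0 ^ 2) * hN2 + w 2 * (p - ε * w 2) * hm2

theorem stableSet_Qstar_mem_nhdsWithin (hmu : 0 < P.mu) (hW0 : 0 < P.potW 0)
    (hk : 0 < P.stiffness) (C h : ℝ) :
    stableSet (P.mcGeheeField C) (P.mcGeheeLevel C h) P.Qstar
      ∈ 𝓝[P.mcGeheeLevel C h] P.Qstar := by
  obtain ⟨S, hS, κ, hκ, hA⟩ := exists_lyapunov_map hmu hW0 hk C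
  have hU : {y : EuclideanSpace ℝ (Fin 4) | y 2 ∈ Ioo (-(Real.pi / 2)) (Real.pi / 2)}
      ∈ 𝓝 P.Qstar :=
    (isOpen_Ioo.preimage (f := fun y : EuclideanSpace ℝ (Fin 4) => y 2) (by fun_prop)).mem_nhds
      (by simp [Qstar_eq, Real.pi_pos])
  have hev := eventually_exists_forward_orbit_tendsto (contDiffAt_mcGeheeField hmu C)
    (mcGeheeField_Qstar hmu hW0 C) S hS hκ hA hU
  filter_upwards [nhdsWithin_le_nhds hev, self_mem_nhdsWithin] with y ⟨γ, h0, hγ, hlim⟩ hy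
  have hd : ∀ τ ∈ Ici (0 : ℝ), HasDerivWithinAt γ (P.mcGeheeField C (γ τ)) (Ici 0) τ :=
    fun τ hτ => (hγ τ hτ).2.hasDerivWithinAt
  have hcont : ContinuousOn (fun τ => γ τ 1) (Ici 0) := fun τ hτ =>
    ((hasDerivWithinAt_euclidean.1 (hd τ hτ)) 1).continuousWithinAt
  obtain ⟨G₁, hG₁⟩ := exists_eq_mul_exp_of_hasDerivWithinAt (f := fun τ => γ τ 0) hcont
    (fun τ hτ => by
      convert hasDerivWithinAt_euclidean.1 (hd τ hτ) 0 using 1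
      simp [mcGeheeField, mul_comm])
  obtain ⟨G₂, hG₂⟩ := exists_eq_mul_exp_of_hasDerivWithinAt
    (f := fun τ => P.energyRelation C h (γ τ)) (g := fun τ => 3 * γ τ 1)
    (continuousOn_const.mul hcont) (fun τ hτ => hasDerivWithinAt_energyRelation hmu h
      (Real.cos_pos_of_mem_Ioo (hγ τ hτ).1) (hd τ hτ))
  refine ⟨γ, h0, fun τ hτ => ⟨⟨?_, (hγ τ hτ).1, ?_⟩, hd τ hτ⟩, hlim⟩
  · rw [hG₁ τ hτ, h0]
    exact mul_nonneg hy.1 (Real.exp_pos _).le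
  · rw [hG₂ τ hτ, h0, hy.2.2, zero_mul]

/-! ### McGehee coordinates -/

/-- The square roots `α`, `β` of the entries of the mass matrix, and all mass factors of the
problem in terms of them. -/
theorem exists_sqrt_masses (hM : 0 < P.M) (hm : 0 < P.m) : ∃ α β : ℝ, 0 < α ∧ 0 < β ∧
    P.M = 2 * α ^ 2 ∧ √(P.M / 2) = α ∧ √(2 / P.M) = α⁻¹ ∧
    √((2 * P.M + P.m) / (2 * P.M * P.m)) = β⁻¹ ∧ √(2 * P.M * P.m / (2 * P.M + P.m)) = β ∧
    (2 * P.M + P.m) / (2 * P.M * P.m) = (β ^ 2)⁻¹ ∧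
    (2 * P.M + P.m) / (4 * P.M * P.m) = (2 * β ^ 2)⁻¹ ∧ P.mu = 4 * α ^ 2 / β ^ 2 := by
  have h1 : 0 < P.M / 2 := by positivity
  have h2 : 0 < 2 * P.M * P.m / (2 * P.M + P.m) := by positivity
  have e1 := Real.sq_sqrt h1.le
  have e2 := Real.sq_sqrt h2.le
  refine ⟨√(P.M / 2), √(2 * P.M * P.m / (2 * P.M + P.m)), Real.sqrt_pos.2 h1, Real.sqrt_pos.2 h2,
    by rw [e1]; ring, rfl, ?_, ?_, rfl, ?_, ?_, ?_⟩
  · rw [← Real.sqrt_inv, inv_div]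
  · rw [← Real.sqrt_inv, inv_div]
  · rw [e2, inv_div]
  · rw [e2]; field_simp; norm_num
  · rw [e1, e2, mu]; field_simp; norm_num

/-- The distance between `m` and the masses `M` in McGehee coordinates. -/
theorem sqrt_sq_add_fromMcGehee (hM : 0 < P.M) (hm : 0 < P.m) {y : EuclideanSpace ℝ (Fin 4)}
    (hr : 0 < y 0) :
    √((P.fromMcGehee y 0) ^ 2 + 4 * (P.fromMcGehee y 1) ^ 2)
      = y 0 * √(Real.cos (y 2) ^ 2 + P.mu * Real.sin (y 2) ^ 2) / √(P.M / 2) := by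
  obtain ⟨α, β, hα, hβ, eM, e1, e2, e3, e4, e5, e6, e7⟩ := exists_sqrt_masses hM hm
  have hD : 0 < Real.cos (y 2) ^ 2 + P.mu * Real.sin (y 2) ^ 2 :=
    cos_sq_add_mu_mul_sin_sq_pos (mu_pos hM hm) _
  rw [e1, ← Real.sqrt_sq (show 0 ≤ y 0 * √(Real.cos (y 2) ^ 2 + P.mu * Real.sin (y 2) ^ 2) / α by
    positivity)]
  congr 1
  simp only [fromMcGehee, e2, e3]
  rw [div_pow, mul_pow, Real.sq_sqrt hD.le, e7]
  simp
  field_simp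

/-- The energy relation in McGehee coordinates is the energy relation multiplied by `r³`. -/
theorem hamiltonian_fromMcGehee (hM : 0 < P.M) (hm : 0 < P.m) (C h : ℝ)
    {y : EuclideanSpace ℝ (Fin 4)} (hr : 0 < y 0) (hcos : 0 < Real.cos (y 2)) :
    y 0 ^ 3 * (P.hamiltonian C (P.fromMcGehee y) - h) = P.energyRelation C h y := by
  have hD := Real.sqrt_pos.2 (cos_sq_add_mu_mul_sin_sq_pos (mu_pos hM hm) (y 2))
  unfold hamiltonian energyRelation potV potW
  rw [sqrt_sq_add_fromMcGehee hM hm hr]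
  obtain ⟨α, β, hα, hβ, eM, e1, e2, e3, e4, e5, e6, e7⟩ := exists_sqrt_masses hM hm
  generalize √(Real.cos (y 2) ^ 2 + P.mu * Real.sin (y 2) ^ 2) = D at *
  simp only [fromMcGehee, e1, e2, e3, e4, e6]
  simp only [eM]
  have hρ := Real.sqrt_pos.2 hr
  have hρ2 := Real.sq_sqrt hr.le
  have hsc := Real.sin_sq_add_cos_sq (y 2)
  generalize √(y 0) = ρ at *
  rw [← hρ2]
  generalize Real.cos (y 2) = c at *
  generalize Real.sin (y 2) = s at *
  simp
  field_simp
  linear_combination D ^ 3 * c ^ 3 * (y 1 ^ 2 + y 3 ^ 2) * hsc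

/-- The change of variables takes solutions of the equations of motion in McGehee coordinates, with
the time rescaled by `dt = r^{5/2} dτ`, to solutions of the Hamiltonian system. -/
theorem hasDerivWithinAt_fromMcGehee (hM : 0 < P.M) (hm : 0 < P.m) {C : ℝ}
    {η : ℝ → EuclideanSpace ℝ (Fin 4)} {S : Set ℝ} {t : ℝ} (hr : 0 < η t 0)
    (hcos : 0 < Real.cos (η t 2))
    (hη : HasDerivWithinAt η ((√(η t 0) ^ 5)⁻¹ • P.mcGeheeField C (η t)) S t) :
    HasDerivWithinAt (fun t => P.fromMcGehee (η t))
      (P.hamiltonianField C (P.fromMcGehee (η t))) S t := by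
  have hmu := mu_pos hM hm
  have hD := Real.sqrt_pos.2 (cos_sq_add_mu_mul_sin_sq_pos hmu (η t 2))
  have hD2 := Real.sq_sqrt (cos_sq_add_mu_mul_sin_sq_pos hmu (η t 2)).le
  have hSD := sqrt_sq_add_fromMcGehee hM hm hr
  have hV := (hasDerivAt_potV hmu hcos).deriv
  have hW := (hasDerivAt_potW hmu hcos).deriv
  have hsc := Real.sin_sq_add_cos_sq (η t 2)
  have hρ := Real.sqrt_pos.2 hr
  have hρ2 := Real.sq_sqrt hr.le
  have hV0 : P.potV (η t 2) = √(P.M / 2) * (P.A / Real.cos (η t 2)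
      + 4 * P.A₁ / √(Real.cos (η t 2) ^ 2 + P.mu * Real.sin (η t 2) ^ 2)) := rfl
  have hW0 : P.potW (η t 2) = √(P.M / 2) ^ 3 * (P.B / Real.cos (η t 2) ^ 3
      + 16 * P.B₁ / √(Real.cos (η t 2) ^ 2 + P.mu * Real.sin (η t 2) ^ 2) ^ 3) := rfl
  rw [hasDerivWithinAt_euclidean] at hη
  have h0 := hη 0
  have h1 := hη 1
  have h2 := hη 2
  have h3 := hη 3
  have hs := h0.sqrt hr.ne'
  have hρ3 : √(η t 0) ^ 3 ≠ 0 := (pow_pos hρ 3).ne'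
  have g2 := ((h1.mul h2.cos).sub (h3.mul h2.sin)).div (hs.pow 3) hρ3
  have g3 := ((h1.mul h2.sin).add (h3.mul h2.cos)).div (hs.pow 3) hρ3
  have g0 := h0.mul h2.cos
  have g1 := h0.mul h2.sin
  obtain ⟨α, β, hα, hβ, eM, e1, e2, e3, e4, e5, e6, e7⟩ := exists_sqrt_masses hM hm
  rw [hasDerivWithinAt_euclidean]
  unfold hamiltonianField
  rw [hSD]
  generalize hDdef : √(Real.cos (η t 2) ^ 2 + P.mu * Real.sin (η t 2) ^ 2) = D at *
  simp only [fromMcGehee, e1, e2, e3, e4]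
  simp only [e5]
  simp only [e1] at hV hW hV0 hW0
  simp only [eM]
  generalize hcdef : Real.cos (η t 2) = c at *
  generalize hsdef : Real.sin (η t 2) = s at *
  -- common denominators, so that the identities for `V` and `W` below become linear in the
  -- relations for `sin`, `cos` and `D`
  have f1 : P.A / c = P.A * c / c ^ 2 := by field_simp
  have f2 : 4 * P.A₁ / D = 4 * P.A₁ * D ^ 2 / D ^ 3 := by field_simp
  have f3 : P.B / c ^ 3 = P.B * c / c ^ 4 := by field_simp
  have f4 : 16 * P.B₁ / D ^ 3 = 16 * P.B₁ * D ^ 2 / D ^ 5 := by field_simp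
  rw [f1, f2] at hV0
  rw [f3, f4] at hW0
  have kV : P.potV (η t 2) * c + deriv P.potV (η t 2) * s
      = α * (P.A / c ^ 2 + 4 * P.A₁ * c / D ^ 3) := by
    rw [hV0, hV]
    linear_combination (α * P.A / c ^ 2 + 4 * α * P.A₁ * c / D ^ 3) * hsc
      + (4 * α * P.A₁ * c / D ^ 3) * hD2
  have kW : 3 * P.potW (η t 2) * c + deriv P.potW (η t 2) * s
      = α ^ 3 * (3 * P.B / c ^ 4 + 48 * P.B₁ * c / D ^ 5) := by
    rw [hW0, hW]
    linear_combination (3 * α ^ 3 * P.B / c ^ 4 + 48 * α ^ 3 * P.B₁ * c / D ^ 5) * hsc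
      + (48 * α ^ 3 * P.B₁ * c / D ^ 5) * hD2
  have lV : P.potV (η t 2) * s - deriv P.potV (η t 2) * c
      = α * (4 * P.A₁ * P.mu * s / D ^ 3) := by
    rw [hV0, hV]
    linear_combination (4 * α * P.A₁ * s / D ^ 3) * (hD2 + P.mu * hsc)
  have lW : 3 * P.potW (η t 2) * s - deriv P.potW (η t 2) * c
      = α ^ 3 * (48 * P.B₁ * P.mu * s / D ^ 5) := by
    rw [hW0, hW]
    linear_combination (48 * α ^ 3 * P.B₁ * s / D ^ 5) * (hD2 + P.mu * hsc)
  rw [e7] at lV lW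
  -- the two contributions of the centrifugal term to `P_R'`
  have hC : C ^ 2 / c ^ 2 * c + C ^ 2 * (s / c ^ 3) * s = C ^ 2 / c ^ 3 := by
    field_simp
    linear_combination C ^ 2 * hsc
  intro i
  fin_cases i
  · refine (g0.const_mul α⁻¹).congr_deriv ?_
    simp [mcGeheeField, hcdef, hsdef]
    generalize √(η t 0) = ρ at *
    rw [← hρ2]
    field_simp
    ring
  · refine (g1.const_mul β⁻¹).congr_deriv ?_
    simp [mcGeheeField, hcdef, hsdef]
    generalize √(η t 0) = ρ at *
    rw [← hρ2]
    field_simp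
  · refine (g2.const_mul α).congr_deriv ?_
    simp [mcGeheeField, hcdef, hsdef]
    generalize P.potV (η t 2) = V at *
    generalize P.potW (η t 2) = W at *
    generalize deriv P.potV (η t 2) = V' at *
    generalize deriv P.potW (η t 2) = W' at *
    generalize √(η t 0) = ρ at *
    rw [← hρ2]
    trans α / ρ ^ 8 * ((C ^ 2 / c ^ 2 * c + C ^ 2 * (s / c ^ 3) * s) * ρ ^ 2
      - ρ ^ 4 * (V * c + V' * s) - (3 * W * c + W' * s))
    · field_simp
      ring
    · rw [hC, kV, kW]
      field_simp
      ring
  · refine (g3.const_mul β).congr_deriv ?_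
    simp [mcGeheeField, hcdef, hsdef]
    generalize P.potV (η t 2) = V at *
    generalize P.potW (η t 2) = W at *
    generalize deriv P.potV (η t 2) = V' at *
    generalize deriv P.potW (η t 2) = W' at *
    generalize √(η t 0) = ρ at *
    rw [← hρ2]
    trans β / ρ ^ 8 * (- ρ ^ 4 * (V * s - V' * c) - (3 * W * s - W' * c))
    · field_simp
      ring
    · rw [lV, lW]
      field_simp
      ring

end IsoscelesParams

/-! ### Return to physical time -/

/-- A function with everywhere positive derivative has a differentiable left inverse. -/
theorem exists_leftInverse_hasDerivAt_of_pos {f f' : ℝ → ℝ} (hf : ∀ x, HasDerivAt f (f' x) x)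
    (hpos : ∀ x, 0 < f' x) :
    ∃ g : ℝ → ℝ, ∀ x, g (f x) = x ∧ HasDerivAt g (f' x)⁻¹ (f x) := by
  have hmono : StrictMono f := strictMono_of_hasDerivAt_pos hf hpos
  have hcont : Continuous f := continuous_iff_continuousAt.2 fun x => (hf x).continuousAt
  have hord : (range f).OrdConnected := (isPreconnected_range hcont).ordConnected
  have hemb := hmono.isEmbedding_of_ordConnected hord
  have hleft : ∀ x, Function.invFun f (f x) = x := Function.leftInverse_invFun hmono.injective
  refine ⟨Function.invFun f, fun x => ⟨hleft x, ?_⟩⟩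
  have hright : ∀ᶠ s in 𝓝 (f x), f (Function.invFun f s) = s := by
    filter_upwards [Ioo_mem_nhds (hmono (sub_one_lt x)) (hmono (lt_add_one x))] with s hs
    obtain ⟨y, rfl⟩ := hord.out (mem_range_self (x - 1)) (mem_range_self (x + 1)) ⟨hs.1.le, hs.2.le⟩
    rw [hleft]
  refine HasDerivAt.of_local_left_inverse (f := f) ?_ ((hleft x).symm ▸ hf x) (hpos x).ne' hright
  rw [ContinuousAt, hemb.tendsto_nhds_iff, hleft]
  exact tendsto_id.congr' (hright.mono fun s hs => hs.symm)

/-- If `t' = p > 0` for all `τ ≥ 0` and `p' ≤ -c p` eventually, then the limit `T` of `t` is finite,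
as `t + p / c` is eventually nonincreasing. The inverse of `t` maps `[0, T)` to `[0, ∞)`. -/
theorem exists_time_change {p p' : ℝ → ℝ} {c τ₀ : ℝ} (hc : 0 < c) (hτ₀ : 0 ≤ τ₀)
    (hp : ∀ τ ∈ Ici (0 : ℝ), HasDerivWithinAt p (p' τ) (Ici 0) τ)
    (hpos : ∀ τ ∈ Ici (0 : ℝ), 0 < p τ) (hdec : ∀ τ, τ₀ ≤ τ → p' τ ≤ -c * p τ) :
    ∃ T : ℝ, 0 < T ∧ ∃ σ : ℝ → ℝ, σ 0 = 0 ∧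
      (∀ s ∈ Ico 0 T, 0 ≤ σ s ∧ HasDerivAt σ (p (σ s))⁻¹ s) ∧ Tendsto σ (𝓝[<] T) atTop := by
  have hcont : Continuous fun τ => p (max τ 0) :=
    (show ContinuousOn p (Ici 0) from fun τ hτ => (hp τ hτ).continuousWithinAt).comp_continuous
      (by fun_prop) fun τ => le_max_right τ 0
  set t : ℝ → ℝ := fun τ => ∫ s in (0 : ℝ)..τ, p (max s 0) with ht
  have htd : ∀ τ, HasDerivAt t (p (max τ 0)) τ := fun τ =>
    intervalIntegral.integral_hasDerivAt_right (hcont.intervalIntegrable _ _)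
      hcont.stronglyMeasurable.stronglyMeasurableAtFilter hcont.continuousAt
  have htpos : ∀ τ, 0 < p (max τ 0) := fun τ => hpos _ (le_max_right τ 0)
  have hmono : StrictMono t := strictMono_of_hasDerivAt_pos htd htpos
  have ht0 : t 0 = 0 := by simp [ht]
  have htc : Continuous t := continuous_iff_continuousAt.2 fun x => (htd x).continuousAt
  have hanti : AntitoneOn (fun τ => t τ + c⁻¹ * p τ) (Ici τ₀) := by
    have hd : ∀ τ ∈ Ici τ₀, HasDerivWithinAt (fun τ => t τ + c⁻¹ * p τ)
        (p (max τ 0) + c⁻¹ * p' τ) (Ici τ₀) τ := fun τ hτ =>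
      (htd τ).hasDerivWithinAt.add
        (((hp τ (hτ₀.trans hτ)).mono (Ici_subset_Ici.2 hτ₀)).const_mul c⁻¹)
    refine antitoneOn_of_hasDerivWithinAt_nonpos (convex_Ici τ₀)
      (fun τ hτ => (hd τ hτ).continuousWithinAt)
      (fun τ hτ => (hd τ (interior_subset hτ)).mono interior_subset) fun τ hτ => ?_
    rw [max_eq_left (hτ₀.trans (interior_subset hτ))]
    have := mul_le_mul_of_nonneg_left (hdec τ (interior_subset hτ)) (inv_pos.2 hc).le
    have e : c⁻¹ * (-c * p τ) = -p τ := by field_simp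
    linarith
  have hbdd : BddAbove (range t) := by
    refine ⟨t τ₀ + c⁻¹ * p τ₀, ?_⟩
    rintro _ ⟨τ, rfl⟩
    have h1 := hanti (mem_Ici.2 le_rfl) (mem_Ici.2 (le_max_right τ τ₀)) (le_max_right τ τ₀)
    have h2 := hmono.monotone (le_max_left τ τ₀)
    have h3 : 0 < c⁻¹ * p (max τ τ₀) :=
      mul_pos (inv_pos.2 hc) (hpos _ (hτ₀.trans (le_max_right τ τ₀)))
    simp only at h1
    linarith
  have hlim := tendsto_atTop_ciSup hmono.monotone hbdd
  set T := ⨆ τ, t τ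
  have hlt : ∀ τ, t τ < T := fun τ => (hmono (lt_add_one τ)).trans_le (le_ciSup hbdd _)
  obtain ⟨σ, hσ⟩ := exists_leftInverse_hasDerivAt_of_pos htd htpos
  have hsurj : ∀ s ∈ Ico 0 T, ∃ τ, 0 ≤ τ ∧ t τ = s := by
    intro s hs
    obtain ⟨τ₁, hτ₁, hs₁⟩ := ((hlim.eventually (lt_mem_nhds hs.2)).and
      (eventually_ge_atTop 0)).exists
    obtain ⟨τ, hτ, rfl⟩ := intermediate_value_Icc hs₁ htc.continuousOn
      (show s ∈ Icc (t 0) (t τ₁) from ⟨ht0.symm ▸ hs.1, hτ₁.le⟩)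
    exact ⟨τ, hτ.1, rfl⟩
  have hT : 0 < T := ht0 ▸ hlt 0
  refine ⟨T, hT, σ, ?_, fun s hs => ?_, ?_⟩
  · simpa only [ht0] using (hσ 0).1
  · obtain ⟨τ, hτ, rfl⟩ := hsurj s hs
    rw [(hσ τ).1]
    exact ⟨hτ, by simpa [max_eq_left hτ] using (hσ τ).2⟩
  · rw [tendsto_atTop]
    intro b
    filter_upwards [Ioo_mem_nhdsLT (max_lt hT (hlt b))] with s hs
    obtain ⟨τ, hτ, rfl⟩ := hsurj s ⟨(le_max_left _ _).trans hs.1.le, hs.2⟩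
    rw [(hσ τ).1]
    exact (hmono.lt_iff_lt.1 ((le_max_right _ _).trans_lt hs.1)).le

namespace IsoscelesParams

variable {P : IsoscelesParams}

theorem fromMcGehee_zero_pos (hM : 0 < P.M) {y : EuclideanSpace ℝ (Fin 4)} (hr : 0 < y 0)
    (hcos : 0 < Real.cos (y 2)) : 0 < P.fromMcGehee y 0 := by
  have : 0 < √(2 / P.M) := Real.sqrt_pos.2 (by positivity)
  simp only [fromMcGehee]
  exact mul_pos this (mul_pos hr hcos)

theorem fromMcGehee_mem_energyLevel (hM : 0 < P.M) (hm : 0 < P.m) {C h : ℝ}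
    {y : EuclideanSpace ℝ (Fin 4)} (hy : y ∈ P.mcGeheeLevel C h) (hr : 0 < y 0) :
    P.fromMcGehee y ∈ P.energyLevel C h := by
  have hcos := cos_pos_of_mem_mcGeheeLevel hy
  refine ⟨fromMcGehee_zero_pos hM hr hcos, ?_⟩
  have h1 := hamiltonian_fromMcGehee hM hm C h hr hcos
  rw [hy.2.2] at h1
  exact sub_eq_zero.1 ((mul_eq_zero.1 h1).resolve_left (pow_pos hr 3).ne')

/-- Along an orbit that converges to `Q*`, `v` tends to a negative number, so that `r` decays
exponentially and the physical time `∫ r^{5/2} dτ` is finite. -/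
theorem fromMcGehee_mem_tripleCollisionSet (hM : 0 < P.M) (hm : 0 < P.m) (hW0 : 0 < P.potW 0)
    {C h : ℝ} {y : EuclideanSpace ℝ (Fin 4)}
    (hy : y ∈ stableSet (P.mcGeheeField C) (P.mcGeheeLevel C h) P.Qstar) (hr : 0 < y 0) :
    P.fromMcGehee y ∈ P.tripleCollisionSet C h := by
  obtain ⟨γ, rfl, hγ, hlim⟩ := hy
  refine ⟨fromMcGehee_mem_energyLevel hM hm (hγ 0 self_mem_Ici).1 hr, ?_⟩
  have hd : ∀ i, ∀ τ ∈ Ici (0 : ℝ),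
      HasDerivWithinAt (fun τ => γ τ i) (P.mcGeheeField C (γ τ) i) (Ici 0) τ :=
    fun i τ hτ => hasDerivWithinAt_euclidean.1 (hγ τ hτ).2 i
  have hlimi : ∀ i, Tendsto (fun τ => γ τ i) atTop (𝓝 (P.Qstar i)) := fun i =>
    ((continuous_apply i).comp (PiLp.continuous_ofLp 2 _)).continuousAt.tendsto.comp hlim
  have hcos : ∀ τ ∈ Ici (0 : ℝ), 0 < Real.cos (γ τ 2) := fun τ hτ =>
    cos_pos_of_mem_mcGeheeLevel (hγ τ hτ).1
  have hrpos : ∀ τ ∈ Ici (0 : ℝ), 0 < γ τ 0 := by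
    obtain ⟨G, hG⟩ := exists_eq_mul_exp_of_hasDerivWithinAt (f := fun τ => γ τ 0)
      (g := fun τ => γ τ 1) (fun τ hτ => (hd 1 τ hτ).continuousWithinAt)
      (fun τ hτ => by simpa [mcGeheeField, mul_comm] using hd 0 τ hτ)
    intro τ hτ
    rw [hG τ hτ]
    exact mul_pos hr (Real.exp_pos _)
  have ha := collisionSpeed_pos hW0
  have hp : ∀ τ ∈ Ici (0 : ℝ), HasDerivWithinAt (fun τ => √(γ τ 0) ^ 5)
      (5 / 2 * γ τ 1 * √(γ τ 0) ^ 5) (Ici 0) τ := by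
    intro τ hτ
    have hs := Real.sqrt_pos.2 (hrpos τ hτ)
    convert! ((hd 0 τ hτ).sqrt (hrpos τ hτ).ne').pow 5 using 1
    simp only [mcGeheeField]
    simp
    have hs2 := Real.sq_sqrt (hrpos τ hτ).le
    generalize √(γ τ 0) = ρ at *
    rw [← hs2]
    field_simp
  have hv : ∀ᶠ τ in atTop, γ τ 1 < -(P.collisionSpeed / 2) :=
    (hlimi 1).eventually (gt_mem_nhds (by simp [Qstar_eq]; linarith))
  obtain ⟨τ₀, hτ₀⟩ := eventually_atTop.1 hv
  obtain ⟨T, hT, σ, hσ0, hσ, hσlim⟩ := exists_time_change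
    (c := 5 / 2 * (P.collisionSpeed / 2)) (τ₀ := max τ₀ 0) (by positivity) (le_max_right _ _) hp
    (fun τ hτ => pow_pos (Real.sqrt_pos.2 (hrpos τ hτ)) 5) (fun τ hτ => by
      have h1 := hτ₀ τ ((le_max_left _ _).trans hτ)
      have h2 := pow_pos (Real.sqrt_pos.2 (hrpos τ ((le_max_right _ _).trans hτ))) 5
      nlinarith)
  refine ⟨T, fun s => P.fromMcGehee (γ (σ s)), hT, by simp only [hσ0], fun s hs => ?_, ?_, ?_⟩
  · have hσs := (hσ s hs).1
    refine ⟨fromMcGehee_zero_pos hM (hrpos _ hσs) (hcos _ hσs), ?_⟩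
    exact hasDerivWithinAt_fromMcGehee hM hm (hrpos _ hσs) (hcos _ hσs)
      (HasDerivWithinAt.scomp s (hγ _ hσs).2 (hσ s hs).2.hasDerivWithinAt
        fun s' hs' => (hσ s' hs').1)
  all_goals
    have h0 := (hlimi 0).comp hσlim
    have h2 := (hlimi 2).comp hσlim
    have h2c := (Real.continuous_cos.tendsto _).comp h2
    have h2s := (Real.continuous_sin.tendsto _).comp h2
  · simpa [fromMcGehee, Qstar_eq] using (h0.mul h2c).const_mul √(2 / P.M)
  · simpa [fromMcGehee, Qstar_eq] using
      (h0.mul h2s).const_mul √((2 * P.M + P.m) / (2 * P.M * P.m))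

/-! ### Positive surface measure -/

/-- The McGehee coordinates `(r, v, θ, u)` of a point `(R, z, P_R, P_z)` with `R > 0`. -/
def toMcGehee (P : IsoscelesParams) (x : EuclideanSpace ℝ (Fin 4)) : EuclideanSpace ℝ (Fin 4) :=
  let X := √(P.M / 2) * x 0
  let Z := √(2 * P.M * P.m / (2 * P.M + P.m)) * x 1
  let p := x 2 / √(P.M / 2)
  let q := x 3 / √(2 * P.M * P.m / (2 * P.M + P.m))
  let r := √(X ^ 2 + Z ^ 2)
  let θ := Real.arctan (Z / X)
  !₂[r, √r ^ 3 * (p * Real.cos θ + q * Real.sin θ), θ,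
    √r ^ 3 * (q * Real.cos θ - p * Real.sin θ)]

theorem toMcGehee_zero_pos (hM : 0 < P.M) {x : EuclideanSpace ℝ (Fin 4)} (hx : 0 < x 0) :
    0 < P.toMcGehee x 0 := by
  have : 0 < √(P.M / 2) := Real.sqrt_pos.2 (by positivity)
  simp only [toMcGehee]
  exact Real.sqrt_pos.2 (by positivity)

theorem fromMcGehee_toMcGehee (hM : 0 < P.M) (hm : 0 < P.m) {x : EuclideanSpace ℝ (Fin 4)}
    (hx : 0 < x 0) : P.fromMcGehee (P.toMcGehee x) = x := by
  obtain ⟨α, β, hα, hβ, -, e1, e2, e3, e4, -, -, -⟩ := exists_sqrt_masses hM hm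
  unfold fromMcGehee toMcGehee
  simp only [e1, e2, e3, e4]
  have hX : 0 < α * x 0 := by positivity
  set X := α * x 0 with hXdef
  set Z := β * x 1 with hZdef
  have hr : 0 < √(X ^ 2 + Z ^ 2) := Real.sqrt_pos.2 (by positivity)
  have hsq : √(1 + (Z / X) ^ 2) = √(X ^ 2 + Z ^ 2) / X := by
    rw [← Real.sqrt_sq hX.le, ← Real.sqrt_div' _ (by positivity)]
    congr 1
    rw [Real.sqrt_sq hX.le]
    field_simp
  have hc : Real.cos (Real.arctan (Z / X)) = X / √(X ^ 2 + Z ^ 2) := by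
    rw [Real.cos_arctan, hsq, one_div_div]
  have hs : Real.sin (Real.arctan (Z / X)) = Z / √(X ^ 2 + Z ^ 2) := by
    rw [Real.sin_arctan, hsq]
    field_simp
  have hρ : 0 < √√(X ^ 2 + Z ^ 2) := Real.sqrt_pos.2 hr
  have hsc := Real.sin_sq_add_cos_sq (Real.arctan (Z / X))
  generalize √(X ^ 2 + Z ^ 2) = r at *
  ext i
  fin_cases i
  · simp [hc]
    field_simp
    rw [hXdef]
  · simp [hs]
    field_simp
    rw [hZdef]
  · simp
    field_simp
    linear_combination x 2 * β * hsc
  · simp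
    field_simp
    linear_combination x 3 * α * hsc

theorem toMcGehee_fromMcGehee_of_axis (hM : 0 < P.M) (hm : 0 < P.m) {r v : ℝ} (hr : 0 < r) :
    P.toMcGehee (P.fromMcGehee !₂[r, v, 0, 0]) = !₂[r, v, 0, 0] := by
  obtain ⟨α, β, hα, hβ, -, e1, e2, e3, e4, -, -, -⟩ := exists_sqrt_masses hM hm
  unfold fromMcGehee toMcGehee
  have hρ := Real.sqrt_pos.2 hr
  ext i
  fin_cases i <;> simp only [e1, e2, e3, e4] <;> simp [hα.ne', Real.sqrt_sq hr.le]
  field_simp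

theorem toMcGehee_mem_mcGeheeLevel (hM : 0 < P.M) (hm : 0 < P.m) {C h : ℝ}
    {x : EuclideanSpace ℝ (Fin 4)} (hx : x ∈ P.energyLevel C h) :
    P.toMcGehee x ∈ P.mcGeheeLevel C h := by
  have hr := toMcGehee_zero_pos hM hx.1
  have hθ : P.toMcGehee x 2 ∈ Ioo (-(Real.pi / 2)) (Real.pi / 2) := by
    simp only [toMcGehee]
    exact Real.arctan_mem_Ioo _
  refine ⟨hr.le, hθ, ?_⟩
  rw [← hamiltonian_fromMcGehee hM hm C h hr (Real.cos_pos_of_mem_Ioo hθ),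
    fromMcGehee_toMcGehee hM hm hx.1, hx.2, sub_self, mul_zero]

theorem continuousAt_toMcGehee (hM : 0 < P.M) (hm : 0 < P.m) {x : EuclideanSpace ℝ (Fin 4)}
    (hx : 0 < x 0) : ContinuousAt P.toMcGehee x := by
  obtain ⟨α, β, hα, hβ, -, e1, -, -, e4, -, -, -⟩ := exists_sqrt_masses hM hm
  unfold toMcGehee
  simp only [e1, e4]
  have hX : α * x 0 ≠ 0 := by positivity
  have hα' := hα.ne'
  have hβ' := hβ.ne'
  have hθ : ContinuousAt (fun x : EuclideanSpace ℝ (Fin 4) =>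
      Real.arctan (β * x 1 / (α * x 0))) x :=
    Real.continuous_arctan.continuousAt.comp (by fun_prop (disch := assumption))
  have hc : ContinuousAt (fun x : EuclideanSpace ℝ (Fin 4) =>
      Real.cos (Real.arctan (β * x 1 / (α * x 0)))) x :=
    Real.continuous_cos.continuousAt.comp hθ
  have hs : ContinuousAt (fun x : EuclideanSpace ℝ (Fin 4) =>
      Real.sin (Real.arctan (β * x 1 / (α * x 0)))) x :=
    Real.continuous_sin.continuousAt.comp hθ
  have hρ : ContinuousAt (fun x : EuclideanSpace ℝ (Fin 4) =>
      √√((α * x 0) ^ 2 + (β * x 1) ^ 2) ^ 3) x := by fun_prop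
  have hp : ContinuousAt (fun x : EuclideanSpace ℝ (Fin 4) => x 2 / α) x := by fun_prop
  have hq : ContinuousAt (fun x : EuclideanSpace ℝ (Fin 4) => x 3 / β) x := by fun_prop
  refine (PiLp.continuous_toLp 2 _).continuousAt.comp (continuousAt_pi.2 fun i => ?_)
  fin_cases i
  · simp; fun_prop
  · exact hρ.mul ((hp.mul hc).add (hq.mul hs))
  · exact hθ
  · exact hρ.mul ((hq.mul hc).sub (hp.mul hs))

theorem continuousAt_hamiltonian (C : ℝ) {x : EuclideanSpace ℝ (Fin 4)} (hx : 0 < x 0) :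
    ContinuousAt (P.hamiltonian C) x := by
  have hS : 0 < √(x 0 ^ 2 + 4 * x 1 ^ 2) := Real.sqrt_pos.2 (by positivity)
  have h1 : x 0 ≠ 0 := hx.ne'
  have h2 : x 0 ^ 2 ≠ 0 := by positivity
  have h3 : x 0 ^ 3 ≠ 0 := by positivity
  have h4 : √(x 0 ^ 2 + 4 * x 1 ^ 2) ≠ 0 := hS.ne'
  have h5 : √(x 0 ^ 2 + 4 * x 1 ^ 2) ^ 3 ≠ 0 := by positivity
  unfold hamiltonian
  fun_prop (disch := assumption)

/-- Points of the energy level with arbitrarily small `r > 0` on the axis `θ = u = 0`, which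
approach `Q*`. -/
theorem exists_axis_mem_mcGeheeLevel (hW0 : 0 < P.potW 0) (C h : ℝ)
    {N : Set (EuclideanSpace ℝ (Fin 4))} (hN : N ∈ 𝓝 P.Qstar) :
    ∃ r v : ℝ, 0 < r ∧ v < 0 ∧ !₂[r, v, 0, 0] ∈ N ∧ !₂[r, v, 0, 0] ∈ P.mcGeheeLevel C h := by
  set f : ℝ → ℝ := fun r => 2 * (P.potW 0 + r ^ 2 * P.potV 0 + h * r ^ 3 - C ^ 2 / 2 * r) with hf
  have hfc : Continuous f := by fun_prop
  have hf0 : f 0 = 2 * P.potW 0 := by simp [hf]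
  have hy : ContinuousAt (fun r : ℝ => (!₂[r, -√(f r), 0, 0] : EuclideanSpace ℝ (Fin 4))) 0 := by
    refine (PiLp.continuous_toLp 2 _).continuousAt.comp (continuousAt_pi.2 fun i => ?_)
    fin_cases i <;> simp <;> fun_prop
  have h1 : ∀ᶠ r in 𝓝 (0 : ℝ), (!₂[r, -√(f r), 0, 0] : EuclideanSpace ℝ (Fin 4)) ∈ N :=
    hy.eventually_mem (by rw [hf0]; exact hN)
  have h2 : ∀ᶠ r in 𝓝 (0 : ℝ), 0 < f r :=
    hfc.continuousAt.eventually (lt_mem_nhds (by rw [hf0]; positivity))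
  obtain ⟨r, ⟨hrN, hfr⟩, hr⟩ := (((h1.and h2).filter_mono nhdsWithin_le_nhds).and
    (self_mem_nhdsWithin (a := (0 : ℝ)) (s := Ioi 0))).exists
  refine ⟨r, -√(f r), hr, neg_lt_zero.2 (Real.sqrt_pos.2 hfr), hrN, (mem_Ioi.1 hr).le, ?_, ?_⟩
  · simp [Real.pi_pos]
  · have := Real.sq_sqrt hfr.le
    simp [energyRelation]
    rw [this, hf]
    ring

/-- The energy level is a graph over `(R, z, P_z)` where `P_R < 0`. -/
def energyGraph (P : IsoscelesParams) (C h : ℝ) (p : EuclideanSpace ℝ (Fin 3)) :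
    EuclideanSpace ℝ (Fin 4) :=
  !₂[p 0, p 1, -√(P.M * (h - P.hamiltonian C !₂[p 0, p 1, 0, p 2])), p 2]

theorem hamiltonian_eq_add (C : ℝ) (x : EuclideanSpace ℝ (Fin 4)) :
    P.hamiltonian C x = 1 / P.M * x 2 ^ 2 + P.hamiltonian C !₂[x 0, x 1, 0, x 3] := by
  simp [hamiltonian]
  ring

theorem energyGraph_mem_energyLevel (hM : 0 < P.M) {C h : ℝ} {p : EuclideanSpace ℝ (Fin 3)}
    (h0 : 0 < p 0) (hp : P.hamiltonian C !₂[p 0, p 1, 0, p 2] < h) :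
    P.energyGraph C h p ∈ P.energyLevel C h := by
  refine ⟨by simpa [energyGraph] using h0, ?_⟩
  rw [hamiltonian_eq_add]
  have h1 : 0 ≤ P.M * (h - P.hamiltonian C !₂[p 0, p 1, 0, p 2]) :=
    mul_nonneg hM.le (sub_nonneg.2 hp.le)
  simp only [energyGraph]
  have h2 := Real.sq_sqrt h1
  simp only [Fin.isValue, Matrix.cons_val, neg_sq, h2]
  field_simp
  ring

theorem continuousAt_slice (C : ℝ) {p : EuclideanSpace ℝ (Fin 3)} (h0 : 0 < p 0) :
    ContinuousAt (fun p : EuclideanSpace ℝ (Fin 3) => P.hamiltonian C !₂[p 0, p 1, 0, p 2]) p := by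
  refine ContinuousAt.comp (g := P.hamiltonian C)
    (continuousAt_hamiltonian C (by simpa using h0)) ?_
  refine (PiLp.continuous_toLp 2 _).continuousAt.comp (continuousAt_pi.2 fun i => ?_)
  fin_cases i <;> simp <;> fun_prop

theorem continuousAt_energyGraph {C : ℝ} (h : ℝ) {p : EuclideanSpace ℝ (Fin 3)} (h0 : 0 < p 0) :
    ContinuousAt (P.energyGraph C h) p := by
  have := continuousAt_slice (P := P) C h0
  refine (PiLp.continuous_toLp 2 _).continuousAt.comp (continuousAt_pi.2 fun i => ?_)
  fin_cases i <;> simp <;> fun_prop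

/-- A set in `ℝ⁴` whose projection along the third coordinate axis has nonempty interior has
positive three-dimensional measure, as the projection is `1`-Lipschitz. -/
theorem _root_.euclideanHausdorffMeasure_pos_of_projection {E : Set (EuclideanSpace ℝ (Fin 4))}
    {U : Set (EuclideanSpace ℝ (Fin 3))} (hU : 0 < volume U)
    (hE : U ⊆ (fun x : EuclideanSpace ℝ (Fin 4) => !₂[x 0, x 1, x 3]) '' E) : 0 < μHE[3] E := by
  have hlip : LipschitzWith 1
      (fun x : EuclideanSpace ℝ (Fin 4) => (!₂[x 0, x 1, x 3] : EuclideanSpace ℝ (Fin 3))) := by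
    refine LipschitzWith.of_dist_le_mul fun x y => ?_
    rw [NNReal.coe_one, one_mul, EuclideanSpace.dist_eq, EuclideanSpace.dist_eq]
    refine Real.sqrt_le_sqrt ?_
    simp [Fin.sum_univ_four, Fin.sum_univ_three]
  have h1 := hlip.hausdorffMeasure_image_le (d := (3 : ℕ)) (by norm_num) E
  rw [ENNReal.coe_one, ENNReal.one_rpow, one_mul] at h1
  rw [← EuclideanSpace.euclideanHausdorffMeasure_eq_volume 3,
    Measure.euclideanHausdorffMeasure_def] at hU
  rw [Measure.euclideanHausdorffMeasure_def]
  refine hU.trans_le ?_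
  simp only [Measure.smul_apply]
  gcongr
  exact (measure_mono hE).trans h1

/-- The triple collision set contains a compact piece of the graph of the energy level over
`(R, z, P_z)`, taken near a point that corresponds to a point of the stable manifold of `Q*`. -/
theorem exists_measurableSet_subset_tripleCollisionSet (hM : 0 < P.M) (hm : 0 < P.m)
    (hW0 : 0 < P.potW 0) (hk : 0 < P.stiffness) (C h : ℝ) :
    ∃ E : Set (EuclideanSpace ℝ (Fin 4)),
      MeasurableSet E ∧ E ⊆ P.tripleCollisionSet C h ∧ 0 < μHE[3] E := by
  obtain ⟨N, hNo, hNq, hN⟩ := mem_nhdsWithin.1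
    (stableSet_Qstar_mem_nhdsWithin (mu_pos hM hm) hW0 hk C h)
  obtain ⟨r, v, hr, hv, hyN, hy⟩ := exists_axis_mem_mcGeheeLevel hW0 C h (hNo.mem_nhds hNq)
  set y : EuclideanSpace ℝ (Fin 4) := !₂[r, v, 0, 0] with hydef
  set x := P.fromMcGehee y with hx
  have hxE : x ∈ P.energyLevel C h := fromMcGehee_mem_energyLevel hM hm hy hr
  have hx2 : x 2 < 0 := by
    obtain ⟨α, β, hα, hβ, -, e1, -⟩ := exists_sqrt_masses hM hm
    have h2 := Real.sqrt_pos.2 hr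
    simp only [hx, fromMcGehee, e1]
    simp [hydef]
    exact mul_neg_of_pos_of_neg hα (div_neg_of_neg_of_pos hv (by positivity))
  have hxy : P.toMcGehee x = y := toMcGehee_fromMcGehee_of_axis hM hm hr
  set p₁ : EuclideanSpace ℝ (Fin 3) := !₂[x 0, x 1, x 3] with hp₁
  have hp0 : 0 < p₁ 0 := hxE.1
  have hslice : P.hamiltonian C !₂[p₁ 0, p₁ 1, 0, p₁ 2] = h - 1 / P.M * x 2 ^ 2 := by
    have := hamiltonian_eq_add (P := P) C x
    rw [hxE.2] at this
    simp only [hp₁, PiLp.toLp_apply, Matrix.cons_val]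
    linarith
  have hgx : P.energyGraph C h p₁ = x := by
    have e : P.M * (h - (h - 1 / P.M * x 2 ^ 2)) = (-x 2) ^ 2 := by field_simp; ring
    unfold energyGraph
    rw [hslice, e, Real.sqrt_sq (by linarith)]
    ext i
    fin_cases i <;> simp [hp₁]
  have hlt : P.hamiltonian C !₂[p₁ 0, p₁ 1, 0, p₁ 2] < h := by
    rw [hslice]
    have : 0 < 1 / P.M * x 2 ^ 2 := by have := hx2.ne; positivity
    linarith
  have hev : ∀ᶠ p in 𝓝 p₁, 0 < p 0 ∧ P.hamiltonian C !₂[p 0, p 1, 0, p 2] < h ∧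
      P.toMcGehee (P.energyGraph C h p) ∈ N := by
    refine Filter.Eventually.and ?_ (Filter.Eventually.and ?_ ?_)
    · exact (show ContinuousAt (fun p : EuclideanSpace ℝ (Fin 3) => p 0) p₁ by
        fun_prop).eventually (lt_mem_nhds hp0)
    · exact (continuousAt_slice C hp0).eventually (gt_mem_nhds hlt)
    · refine ContinuousAt.eventually_mem (ContinuousAt.comp (g := P.toMcGehee) ?_
        (continuousAt_energyGraph h hp0)) ?_
      · rw [hgx]; exact continuousAt_toMcGehee hM hm hxE.1
      · rw [Function.comp_apply, hgx, hxy]; exact hNo.mem_nhds hyN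
  obtain ⟨ε, hε, hball⟩ := Metric.nhds_basis_closedBall.eventually_iff.1 hev
  refine ⟨P.energyGraph C h '' Metric.closedBall p₁ ε, ?_, ?_, ?_⟩
  · refine ((isCompact_closedBall p₁ ε).image_of_continuousOn fun p hp => ?_).measurableSet
    exact (continuousAt_energyGraph h (hball hp).1).continuousWithinAt
  · rintro _ ⟨p, hp, rfl⟩
    obtain ⟨h0, h1, h2⟩ := hball hp
    have hmem := energyGraph_mem_energyLevel hM h0 h1
    rw [← fromMcGehee_toMcGehee hM hm hmem.1]
    exact fromMcGehee_mem_tripleCollisionSet hM hm hW0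
      (hN ⟨h2, toMcGehee_mem_mcGeheeLevel hM hm hmem⟩) (toMcGehee_zero_pos hM hmem.1)
  · refine euclideanHausdorffMeasure_pos_of_projection
      (Metric.measure_closedBall_pos volume p₁ hε) fun p hp => ⟨_, ⟨p, hp, rfl⟩, ?_⟩
    ext i
    fin_cases i <;> simp [energyGraph]

end IsoscelesParams

end

theorem mainTheorem1 (P : IsoscelesParams)
    (hM : 0 < P.M) (hm : 0 < P.m)
    (hA : 0 < P.A) (hB : 0 < P.B) (hA₁ : 0 < P.A₁) (hB₁ : 0 < P.B₁)
    (hmuA : 1 + P.A / (4 * P.A₁) < P.mu)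
    (hmuB : 1 + P.B / (16 * P.B₁) < P.mu)
    (hgen : (P.mu - 1) ^ (4 / 15 : ℝ) * (4 * P.A₁ / P.A) ^ (2 / 3 : ℝ)
      ≠ (16 * P.B₁ / P.B) ^ (2 / 5 : ℝ))
    (C h : ℝ) :
    -- positive three-dimensional Lebesgue (surface) measure on the energy level
    0 < μHE[3] (P.tripleCollisionSet C h) ∧
    (∃ E : Set (EuclideanSpace ℝ (Fin 4)),
      MeasurableSet E ∧ E ⊆ P.tripleCollisionSet C h ∧ 0 < μHE[3] E) ∧
    -- `Q*` is a hyperbolic sink on the regularized energy level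
    P.Qstar ∈ P.collisionManifold ∧
    IsHyperbolicSinkOn (P.mcGeheeField C) (P.energyRelation C h) P.Qstar ∧
    -- its stable manifold has full dimension in the regularized energy level
    stableSet (P.mcGeheeField C) (P.mcGeheeLevel C h) P.Qstar
      ∈ 𝓝[P.mcGeheeLevel C h] P.Qstar ∧
    -- and the orbits of the stable manifold with `r > 0` are triple collision orbits
    (∀ y ∈ stableSet (P.mcGeheeField C) (P.mcGeheeLevel C h) P.Qstar, 0 < y 0 →
      P.fromMcGehee y ∈ P.tripleCollisionSet C h) := by
  have hmu := IsoscelesParams.mu_pos hM hm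
  have hW0 := IsoscelesParams.potW_zero_pos hM hB hB₁
  have hk := IsoscelesParams.stiffness_pos hM hB₁ hmuB
  obtain ⟨E, hE, hsub, hpos⟩ :=
    IsoscelesParams.exists_measurableSet_subset_tripleCollisionSet hM hm hW0 hk C h
  exact ⟨hpos.trans_le (measure_mono hsub), ⟨E, hE, hsub, hpos⟩,
    IsoscelesParams.Qstar_mem_collisionManifold hW0,
    IsoscelesParams.isHyperbolicSinkOn_Qstar hmu hW0 hk C h,
    IsoscelesParams.stableSet_Qstar_mem_nhdsWithin hmu hW0 hk C h,
    fun y hy hr => IsoscelesParams.fromMcGehee_mem_tripleCollisionSet hM hm hW0 hy hr⟩
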